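/- Let $d\ge 1$, let $a:\mathbb R^d\to\mathbb R^d$ and $v:\mathbb R^d\to\mathbb R$ be measurable, $v_\pm=(|v|\pm v)/2$, with $|a|^2, v_+\in L^1_{\rm loc}(\mathbb R^d)$. Definitions. For open $G\subseteq\mathbb R^d$ let $W^{1,2}_a(G)$ be the space of $\varphi\in L^2(G)$ for which there are $(i\nabla+a)_j\varphi\in L^2(G)$, $j=1,\dots,d$, with $\langle\varphi,(i\partial_j+a_j)\eta\rangle=\langle(i\nabla+a)_j\varphi,\eta\rangle$ for all $\eta\in C_0^\infty(G)$, and let $h^{a,0}_{G,N}(\varphi,\psi)=\frac12\sum_j\langle(i\nabla+a)_j\varphi,(i\nabla+a)_j\psi\rangle$ on $W^{1,2}_a(G)$. Let $h^{a,0}_{G,D}$ be the restriction of $h^{a,0}_{G,N}$ to the closure of $C_0^\infty(G)$ in $W_a^{1,2}(G)$ with respect to the norm $(\|\varphi\|^2+h^{a,0}_{G,N}(\varphi,\varphi))^{1/2}$. For $X\in\{D,N\}$, $v_-$ is called a form perturbation of $H_{G,X}(a,0)$ if there are $0\le\alpha<1$ and $\beta\in\mathbb R$ such that every $\varphi$ in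 the domain of $h^{a,0}_{G,X}$ satisfies $v_-^{1/2}\varphi\in L^2(G)$ and $\|v_-^{1/2}\varphi\|^2\le\alpha\, h^{a,0}_{G,X}(\varphi,\varphi)+\beta\|\varphi\|^2$. In that case put $$h^{a,v}_{G,X}(\varphi,\psi)=h^{a,0}_{G,X}(\varphi,\psi)+\langle v_+^{1/2}\varphi,v_+^{1/2}\psi\rangle-\langle v_-^{1/2}\varphi,v_-^{1/2}\psi\rangle$$ for $\varphi,\psi$ in the domain of $h^{a,0}_{G,X}$ with $v_+^{1/2}\varphi,v_+^{1/2}\psi\in L^2(G)$, and let $H_{G,X}(a,v)$ be the operator on $L^2(G)$ associated with this form: $\psi$ is in its domain with $H_{G,X}(a,v)\psi=\chi$ if and only if $\psi$ is in the form domain and $h^{a,v}_{G,X}(\varphi,\psi)=\langle\varphi,\chi\rangle$ for all $\varphi$ in the form domain. For self-adjoint operators $A,B$ bounded below, $A\le B$ in the sense of forms means that the form domain of $B$ is contained in that of $A$ and that on it the quadratic form of $A$ is at most that of $B$. Proposition. Let $\Lambda_1,\Lambda_2\subset\mathbb R^d$ be disjoint non-empty open sets and let $v_-$ be a form perturbation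 of $H_{\Lambda_1\cup\Lambda_2,N}(a,0)$. (i) For $X\in\{D,N\}$ and $G\in\{\Lambda_1,\Lambda_2,\Lambda_1\cup\Lambda_2\}$, $v_-$ is a form perturbation of $H_{G,X}(a,0)$, the form $h^{a,v}_{G,X}$ is densely defined, symmetric, bounded below and closed, and $H_{G,X}(a,v)$ is self-adjoint. Moreover $$H_{\Lambda_1\cup\Lambda_2,X}(a,v)=H_{\Lambda_1,X}(a,v)\oplus H_{\Lambda_2,X}(a,v)$$ on $L^2(\Lambda_1\cup\Lambda_2)=L^2(\Lambda_1)\oplus L^2(\Lambda_2)$, for both $X=D$ and $X=N$. (ii) Let $\Lambda$ be the interior of the closure of $\Lambda_1\cup\Lambda_2$ and suppose that $\Lambda\setminus(\Lambda_1\cup\Lambda_2)$ has Lebesgue measure zero, so that $L^2(\Lambda)=L^2(\Lambda_1\cup\Lambda_2)$. Then the assertions on $h^{a,v}_{G,X}$ and $H_{G,X}(a,v)$ in the first sentence of (i) hold for $G=\Lambda$ too, and $$H_{\Lambda_1\cup\Lambda_2,N}(a,v)\le H_{\Lambda,N}(a,v)\le H_{\Lambda,D}(a,v)\le H_{\Lambda_1\cup\Lambda_2,D}(a,v)$$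 in the sense of forms. -/

import Mathlib

open MeasureTheory Filter Topology
open scoped ContDiff InnerProductSpace

namespace MagSchr

/-! ## Sesquilinear forms on dense subspaces of a Hilbert space and their operators -/

section AbstractForms

variable {E : Type*} [NormedAddCommGroup E] [InnerProductSpace ℂ E]
variable {F : Type*} [NormedAddCommGroup F] [InnerProductSpace ℂ F]

/-- A sesquilinear form, conjugate-linear in the first argument, defined on a linear subspace
`dom` (its form domain) of `E`. -/
structure SesqForm (E : Type*) [NormedAddCommGroup E] [InnerProductSpace ℂ E] where
  /-- the form domain -/
  dom : Submodule ℂ E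
  /-- the form -/
  form : dom →ₗ⋆[ℂ] dom →ₗ[ℂ] ℂ

namespace SesqForm

/-- The values of a form on a subspace `p` of its domain. -/
def onSubspace (q : SesqForm E) (p : Submodule ℂ E) (hp : p ≤ q.dom) : p →ₗ⋆[ℂ] p →ₗ[ℂ] ℂ :=
  LinearMap.mk₂'ₛₗ (starRingEnd ℂ) (RingHom.id ℂ)
    (fun φ ψ => q.form (Submodule.inclusion hp φ) (Submodule.inclusion hp ψ))
    (by intros; simp) (by intros; simp) (by intros; simp) (by intros; simp)

/-- The restriction of a form to a subspace `p` of its domain. -/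
def restrict (q : SesqForm E) (p : Submodule ℂ E) (hp : p ≤ q.dom) : SesqForm E where
  dom := p
  form := q.onSubspace p hp

/-- The form `(φ, ψ) ↦ ⟪T φ, T ψ⟫` with form domain the domain of the operator `T`. -/
noncomputable def ofOp (T : E →ₗ.[ℂ] F) : SesqForm E where
  dom := T.domain
  form := LinearMap.mk₂'ₛₗ (starRingEnd ℂ) (RingHom.id ℂ)
    (fun φ ψ => ⟪T φ, T ψ⟫_ℂ)
    (by intros; rw [LinearPMap.map_add, inner_add_left])
    (by intros; rw [LinearPMap.map_smul, inner_smul_left]; rfl)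
    (by intros; rw [LinearPMap.map_add, inner_add_right])
    (by intros; rw [LinearPMap.map_smul, inner_smul_right]; rfl)

/-- The sum of two forms, on the intersection of the form domains. -/
noncomputable def add (p q : SesqForm E) : SesqForm E where
  dom := p.dom ⊓ q.dom
  form := p.onSubspace (p.dom ⊓ q.dom) inf_le_left +
    q.onSubspace (p.dom ⊓ q.dom) inf_le_right

/-- The difference of two forms, on the intersection of the form domains. -/
noncomputable def sub (p q : SesqForm E) : SesqForm E where
  dom := p.dom ⊓ q.dom
  form := p.onSubspace (p.dom ⊓ q.dom) inf_le_left -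
    q.onSubspace (p.dom ⊓ q.dom) inf_le_right

/-- The form is densely defined, symmetric, bounded below and closed. Closedness is completeness
of the form domain for the form norm: if `u n ∈ dom`, `u n → φ` in the Hilbert space and
`q (u m - u n, u m - u n) → 0` as `m, n → ∞`, then `φ ∈ dom` and `q (u n - φ, u n - φ) → 0`. -/
structure IsClosedSemibounded (q : SesqForm E) : Prop where
  dense : Dense (q.dom : Set E)
  symmetric : ∀ φ ψ : q.dom, q.form ψ φ = starRingEnd ℂ (q.form φ ψ)
  bounded_below : ∃ m : ℝ, ∀ φ : q.dom, m * ‖(φ : E)‖ ^ 2 ≤ (q.form φ φ).re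
  closed : ∀ (u : ℕ → q.dom) (φ : E), Tendsto (fun n => (u n : E)) atTop (𝓝 φ) →
    Tendsto (fun p : ℕ × ℕ => q.form (u p.1 - u p.2) (u p.1 - u p.2)) atTop (𝓝 0) →
    ∃ hφ : φ ∈ q.dom,
      Tendsto (fun n => q.form (u n - ⟨φ, hφ⟩) (u n - ⟨φ, hφ⟩)) atTop (𝓝 0)

/-- The graph of the operator associated with the form `q`: the pairs `(ψ, χ)` with
`ψ ∈ dom` and `q (φ, ψ) = ⟪φ, χ⟫` for all `φ ∈ dom`. -/
def operatorGraph (q : SesqForm E) : Submodule ℂ (E × E) where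
  carrier := {x | ∃ hx : x.1 ∈ q.dom, ∀ φ : q.dom, q.form φ ⟨x.1, hx⟩ = ⟪(φ : E), x.2⟫_ℂ}
  add_mem' := by
    rintro x y ⟨hx, hx'⟩ ⟨hy, hy'⟩
    refine ⟨q.dom.add_mem hx hy, fun φ => ?_⟩
    have : (⟨(x + y).1, q.dom.add_mem hx hy⟩ : q.dom) = ⟨x.1, hx⟩ + ⟨y.1, hy⟩ := rfl
    rw [this, map_add, hx', hy', Prod.snd_add, inner_add_right]
  zero_mem' := by
    refine ⟨q.dom.zero_mem, fun φ => ?_⟩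
    have : (⟨(0 : E × E).1, q.dom.zero_mem⟩ : q.dom) = 0 := rfl
    rw [this]; simp
  smul_mem' := by
    rintro c x ⟨hx, hx'⟩
    refine ⟨q.dom.smul_mem c hx, fun φ => ?_⟩
    have : (⟨(c • x).1, q.dom.smul_mem c hx⟩ : q.dom) = c • ⟨x.1, hx⟩ := rfl
    rw [this, map_smul, hx', Prod.smul_snd, inner_smul_right, smul_eq_mul]

/-- The operator associated with a (densely defined) form. -/
noncomputable def operator (q : SesqForm E) : E →ₗ.[ℂ] E := q.operatorGraph.toLinearPMap

/-- For a densely defined form the operator has the intended graph. -/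
theorem mem_graph_operator (q : SesqForm E) (hq : Dense (q.dom : Set E)) (ψ χ : E) :
    (ψ, χ) ∈ q.operator.graph ↔
      ∃ hψ : ψ ∈ q.dom, ∀ φ : q.dom, q.form φ ⟨ψ, hψ⟩ = ⟪(φ : E), χ⟫_ℂ := by
  rw [operator, Submodule.toLinearPMap_graph_eq]
  · rfl
  · rintro ⟨x, y⟩ ⟨hx, hx'⟩ h0
    have h0' : (⟨x, hx⟩ : q.dom) = 0 := Subtype.ext h0
    refine hq.eq_zero_of_inner_right (𝕜 := ℂ) fun v hv => ?_
    have h := hx' ⟨v, hv⟩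
    rw [h0', map_zero] at h
    exact h.symm

/-- The form `w` is a form perturbation of the positive form `q` (that is, of the operator
of `q`): it is form-bounded relative to `q` with form bound strictly smaller than one. -/
def IsFormPerturbation (w q : SesqForm E) : Prop :=
  ∃ hdom : q.dom ≤ w.dom, ∃ α β : ℝ, 0 ≤ α ∧ α < 1 ∧ ∀ φ : q.dom,
    ‖w.form (Submodule.inclusion hdom φ) (Submodule.inclusion hdom φ)‖ ≤
      α * (q.form φ φ).re + β * ‖(φ : E)‖ ^ 2

end SesqForm

/-- `A ≤ B` in the sense of forms, for self-adjoint operators bounded below, `A` on `E` and `B`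
on `F`, where `F` is regarded as a subspace of `E` by means of the isometry `V`: the form domain
of `B` is contained in that of `A`, and there the quadratic form of `A` is at most that of `B`.
Here the forms `a` of `A` and `b` of `B` are the closed ones to which the operators belong;
each is determined by its operator. -/
def FormLE [CompleteSpace E] [CompleteSpace F] (V : F →ₗᵢ[ℂ] E) (A : E →ₗ.[ℂ] E) (B : F →ₗ.[ℂ] F) : Prop :=
  IsSelfAdjoint A ∧ IsSelfAdjoint B ∧
  ∃ (a : SesqForm E) (b : SesqForm F),
    a.IsClosedSemibounded ∧ b.IsClosedSemibounded ∧ a.operator = A ∧ b.operator = B ∧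
    ∀ φ : b.dom, ∃ hφ : V φ ∈ a.dom, (a.form ⟨V φ, hφ⟩ ⟨V φ, hφ⟩).re ≤ (b.form φ φ).re

/-- The orthogonal sum `A ⊕ B` of two operators on the Hilbert sum of the spaces. -/
noncomputable def orthSum (A : E →ₗ.[ℂ] E) (B : F →ₗ.[ℂ] F) :
    WithLp 2 (E × F) →ₗ.[ℂ] WithLp 2 (E × F) where
  domain :=
    { carrier := {x | x.fst ∈ A.domain ∧ x.snd ∈ B.domain}
      add_mem' := fun hx hy => ⟨A.domain.add_mem hx.1 hy.1, B.domain.add_mem hx.2 hy.2⟩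
      zero_mem' := ⟨A.domain.zero_mem, B.domain.zero_mem⟩
      smul_mem' := fun c _ hx => ⟨A.domain.smul_mem c hx.1, B.domain.smul_mem c hx.2⟩ }
  toFun :=
    { toFun := fun x => WithLp.toLp 2 (A ⟨(x : WithLp 2 (E × F)).fst, x.2.1⟩,
        B ⟨(x : WithLp 2 (E × F)).snd, x.2.2⟩)
      map_add' := fun x y => by
        rw [← WithLp.toLp_add, Prod.mk_add_mk, ← A.map_add, ← B.map_add]; rfl
      map_smul' := fun c x => by
        rw [RingHom.id_apply, ← WithLp.toLp_smul, Prod.smul_mk, ← A.map_smul, ← B.map_smul]; rfl }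

/-- The operators `A` and `B` are identified by the unitary `U`, that is, `A = U⁻¹ B U`
including domains. -/
def EqVia (U : E ≃ₗᵢ[ℂ] F) (A : E →ₗ.[ℂ] E) (B : F →ₗ.[ℂ] F) : Prop :=
  ∀ ψ χ : E, (ψ, χ) ∈ A.graph ↔ (U ψ, U χ) ∈ B.graph

end AbstractForms

/-! ## The Hilbert spaces `L²(Λ)` -/

section Spaces

variable {d : ℕ}

/-- `L²(Λ)` for `Λ ⊆ ℝᵈ`, with complex-valued functions and Lebesgue measure. -/
abbrev L2 (Λ : Set (EuclideanSpace ℝ (Fin d))) : Type :=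
  Lp ℂ 2 ((volume : Measure (EuclideanSpace ℝ (Fin d))).restrict Λ)

/-- Restriction of functions, `L²(S) → L²(T)` for `T ⊆ S`. -/
noncomputable def restrictL2 {S T : Set (EuclideanSpace ℝ (Fin d))} (h : T ⊆ S) :
    L2 S →ₗ[ℂ] L2 T where
  toFun f := ((Lp.memLp f).mono_measure (Measure.restrict_mono_set volume h)).toLp f
  map_add' f g := by
    rw [← MemLp.toLp_add]
    exact MemLp.toLp_congr _ _ (ae_mono (Measure.restrict_mono_set volume h) (Lp.coeFn_add f g))
  map_smul' c f := by
    rw [RingHom.id_apply, ← MemLp.toLp_const_smul]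
    exact MemLp.toLp_congr _ _ (ae_mono (Measure.restrict_mono_set volume h) (Lp.coeFn_smul c f))

theorem coeFn_restrictL2 {S T : Set (EuclideanSpace ℝ (Fin d))} (h : T ⊆ S) (f : L2 S) :
    restrictL2 h f =ᵐ[volume.restrict T] f :=
  MemLp.coeFn_toLp ((Lp.memLp f).mono_measure (Measure.restrict_mono_set volume h))

theorem norm_sq_L2 {S : Set (EuclideanSpace ℝ (Fin d))} (f : L2 S) :
    ‖f‖ ^ 2 = ∫ x in S, ‖f x‖ ^ 2 := by
  have h := L2.inner_def (𝕜 := ℂ) f f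
  rw [inner_self_eq_norm_sq_to_K] at h
  simp_rw [inner_self_eq_norm_sq_to_K] at h
  norm_cast at h

theorem norm_sq_restrictL2 {S T : Set (EuclideanSpace ℝ (Fin d))} (h : T ⊆ S) (f : L2 S) :
    ‖restrictL2 h f‖ ^ 2 = ∫ x in T, ‖f x‖ ^ 2 := by
  rw [norm_sq_L2]
  refine integral_congr_ae ?_
  filter_upwards [coeFn_restrictL2 h f] with x hx
  rw [hx]

/-- The isometric part of the decomposition `L²(S ∪ T) = L²(S) ⊕ L²(T)`. -/
noncomputable def splitIsometry {S T : Set (EuclideanSpace ℝ (Fin d))}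
    (hT : MeasurableSet T) (hST : Disjoint S T) :
    L2 (S ∪ T) →ₗᵢ[ℂ] WithLp 2 (L2 S × L2 T) where
  toFun f := WithLp.toLp 2
    (restrictL2 Set.subset_union_left f, restrictL2 Set.subset_union_right f)
  map_add' f g := by rw [map_add, map_add]; rfl
  map_smul' c f := by rw [map_smul, map_smul]; rfl
  norm_map' f := by
    refine (sq_eq_sq₀ (norm_nonneg _) (norm_nonneg _)).1 ?_
    have hint : Integrable (fun x => ‖f x‖ ^ 2) (volume.restrict (S ∪ T)) :=
      (memLp_two_iff_integrable_sq_norm (Lp.aestronglyMeasurable f)).1 (Lp.memLp f)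
    rw [WithLp.prod_norm_sq_eq_of_L2, norm_sq_L2 f]
    change ‖restrictL2 Set.subset_union_left f‖ ^ 2 + ‖restrictL2 Set.subset_union_right f‖ ^ 2 = _
    rw [norm_sq_restrictL2, norm_sq_restrictL2]
    exact (setIntegral_union hST hT (hint.mono_measure
      (Measure.restrict_mono_set volume Set.subset_union_left)) (hint.mono_measure
      (Measure.restrict_mono_set volume Set.subset_union_right))).symm

theorem splitIsometry_surjective {S T : Set (EuclideanSpace ℝ (Fin d))}
    (hS : MeasurableSet S) (hT : MeasurableSet T) (hST : Disjoint S T) :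
    Function.Surjective (splitIsometry hT hST) := by
  classical
  intro y
  have hS1 : MemLp (S.indicator y.fst) 2 (volume : Measure (EuclideanSpace ℝ (Fin d))) :=
    (memLp_indicator_iff_restrict hS).2 (Lp.memLp y.fst)
  have hT1 : MemLp (T.indicator y.snd) 2 (volume : Measure (EuclideanSpace ℝ (Fin d))) :=
    (memLp_indicator_iff_restrict hT).2 (Lp.memLp y.snd)
  have hm := (hS1.add hT1).restrict (S ∪ T)
  have hc := hm.coeFn_toLp
  refine ⟨hm.toLp, ?_⟩
  apply (WithLp.equiv 2 _).injective
  refine Prod.ext (Lp.ext ?_) (Lp.ext ?_)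
  · refine (coeFn_restrictL2 Set.subset_union_left hm.toLp).trans ?_
    filter_upwards [ae_mono (Measure.restrict_mono_set volume Set.subset_union_left) hc,
      ae_restrict_mem hS] with x hx hxS
    rw [hx, Pi.add_apply, Set.indicator_of_mem hxS,
      Set.indicator_of_notMem (Set.disjoint_left.1 hST hxS), add_zero]
    rfl
  · refine (coeFn_restrictL2 Set.subset_union_right hm.toLp).trans ?_
    filter_upwards [ae_mono (Measure.restrict_mono_set volume Set.subset_union_right) hc,
      ae_restrict_mem hT] with x hx hxT
    rw [hx, Pi.add_apply, Set.indicator_of_mem hxT,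
      Set.indicator_of_notMem (Set.disjoint_right.1 hST hxT), zero_add]
    rfl

/-- The decomposition `L²(S ∪ T) = L²(S) ⊕ L²(T)`, `f ↦ (f|_S, f|_T)`, for disjoint `S`, `T`. -/
noncomputable def splitL2 {S T : Set (EuclideanSpace ℝ (Fin d))}
    (hS : MeasurableSet S) (hT : MeasurableSet T) (hST : Disjoint S T) :
    L2 (S ∪ T) ≃ₗᵢ[ℂ] WithLp 2 (L2 S × L2 T) :=
  LinearIsometryEquiv.ofSurjective (splitIsometry hT hST) (splitIsometry_surjective hS hT hST)

/-- The identification of `L²(S)` with `L²(T)` by restriction, for `T ⊆ S` with `S \ T` of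
Lebesgue measure zero. -/
noncomputable def nullRestrictL2 {S T : Set (EuclideanSpace ℝ (Fin d))} (h : T ⊆ S)
    (h0 : volume (S \ T) = 0) : L2 S ≃ₗᵢ[ℂ] L2 T :=
  have hμ : (volume : Measure (EuclideanSpace ℝ (Fin d))).restrict S = volume.restrict T :=
    Measure.restrict_congr_set
      ((ae_le_set.2 h0).antisymm (Eventually.of_forall (fun _ hx => h hx)))
  LinearIsometryEquiv.ofSurjective
    { restrictL2 h with
      norm_map' := fun f => by
        refine (sq_eq_sq₀ (norm_nonneg _) (norm_nonneg _)).1 ?_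
        change ‖restrictL2 h f‖ ^ 2 = _
        rw [norm_sq_restrictL2, norm_sq_L2]
        exact congrArg (fun μ => ∫ x, ‖f x‖ ^ 2 ∂μ) hμ.symm }
    (fun g => by
      have hm : MemLp g 2 (volume.restrict S) := by rw [hμ]; exact Lp.memLp g
      refine ⟨hm.toLp, Lp.ext ?_⟩
      refine (coeFn_restrictL2 h hm.toLp).trans ?_
      exact ae_mono hμ.ge hm.coeFn_toLp)

end Spaces

/-! ## Magnetic Schrödinger operators -/

section Magnetic

variable {d : ℕ}

/-- `η ∈ C₀^∞(Λ)`, extended by zero to `ℝᵈ`. -/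
def IsTest (Λ : Set (EuclideanSpace ℝ (Fin d))) (η : EuclideanSpace ℝ (Fin d) → ℂ) : Prop :=
  ContDiff ℝ ∞ η ∧ HasCompactSupport η ∧ tsupport η ⊆ Λ

theorem IsTest.add {Λ : Set (EuclideanSpace ℝ (Fin d))} {η θ : EuclideanSpace ℝ (Fin d) → ℂ}
    (hη : IsTest Λ η) (hθ : IsTest Λ θ) : IsTest Λ (η + θ) :=
  ⟨hη.1.add hθ.1, hη.2.1.add hθ.2.1,
    (tsupport_add η θ).trans (Set.union_subset hη.2.2 hθ.2.2)⟩

theorem IsTest.zero (Λ : Set (EuclideanSpace ℝ (Fin d))) :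
    IsTest Λ (0 : EuclideanSpace ℝ (Fin d) → ℂ) :=
  ⟨contDiff_const, HasCompactSupport.zero, by simp [tsupport]⟩

theorem IsTest.smul {Λ : Set (EuclideanSpace ℝ (Fin d))} {η : EuclideanSpace ℝ (Fin d) → ℂ}
    (hη : IsTest Λ η) (c : ℂ) : IsTest Λ (c • η) :=
  ⟨contDiff_const.smul hη.1, hη.2.1.smul_left,
    (closure_mono (Function.support_const_smul_subset c η)).trans hη.2.2⟩

/-- `(i∇ + a)_j η = i ∂_j η + a_j η` for a smooth function `η`. -/
noncomputable def covDeriv (a : EuclideanSpace ℝ (Fin d) → EuclideanSpace ℝ (Fin d)) (j : Fin d)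
    (η : EuclideanSpace ℝ (Fin d) → ℂ) : EuclideanSpace ℝ (Fin d) → ℂ :=
  fun x => Complex.I * fderiv ℝ η x (EuclideanSpace.single j 1) + (a x j : ℂ) * η x

/-- The graph of the distributional operator `(i∇ + a)_j` in `L²(Λ)`: the pairs `(φ, φ_j)` with
`⟪φ, i ∂_j η + a_j η⟫ = ⟪φ_j, η⟫` for all `η ∈ C₀^∞(Λ)`. The elements `e` and `g` of `L²(Λ)`
stand for the classes of `η` and of `i ∂_j η + a_j η`; both exist if `a` is locally square
integrable, see `mem_magGraph_iff`. -/
def magGraph (Λ : Set (EuclideanSpace ℝ (Fin d)))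
    (a : EuclideanSpace ℝ (Fin d) → EuclideanSpace ℝ (Fin d)) (j : Fin d) :
    Submodule ℂ (L2 Λ × L2 Λ) where
  carrier := {x | ∀ η, IsTest Λ η → ∀ e g : L2 Λ, e =ᵐ[volume.restrict Λ] η →
    g =ᵐ[volume.restrict Λ] covDeriv a j η → ⟪x.1, g⟫_ℂ = ⟪x.2, e⟫_ℂ}
  add_mem' := fun {x y} hx hy η hη e g he hg => by
    rw [Prod.fst_add, Prod.snd_add, inner_add_left, inner_add_left, hx η hη e g he hg,
      hy η hη e g he hg]
  zero_mem' := fun η hη e g he hg => by simp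
  smul_mem' := fun c x hx η hη e g he hg => by
    rw [Prod.smul_fst, Prod.smul_snd, inner_smul_left, inner_smul_left, hx η hη e g he hg]

theorem IsTest.memLp {Λ : Set (EuclideanSpace ℝ (Fin d))} {η : EuclideanSpace ℝ (Fin d) → ℂ}
    (hη : IsTest Λ η) : MemLp η 2 (volume.restrict Λ) :=
  (hη.1.continuous.memLp_of_hasCompactSupport hη.2.1).restrict Λ

theorem IsTest.memLp_covDeriv {Λ : Set (EuclideanSpace ℝ (Fin d))}
    {η : EuclideanSpace ℝ (Fin d) → ℂ} (hη : IsTest Λ η)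
    {a : EuclideanSpace ℝ (Fin d) → EuclideanSpace ℝ (Fin d)}
    (ha : AEStronglyMeasurable a volume) (ha2 : LocallyIntegrable (fun x => ‖a x‖ ^ 2) volume)
    (j : Fin d) : MemLp (covDeriv a j η) 2 (volume.restrict Λ) := by
  refine MemLp.restrict Λ (MemLp.add ?_ ?_)
  · have hc : Continuous fun x => fderiv ℝ η x (EuclideanSpace.single j 1) :=
      (hη.1.continuous_fderiv (by simp)).clm_apply continuous_const
    have hs : HasCompactSupport fun x => fderiv ℝ η x (EuclideanSpace.single j 1) :=
      hη.2.1.fderiv_apply ℝ _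
    exact (hc.memLp_of_hasCompactSupport hs).const_mul Complex.I
  · have hm : AEStronglyMeasurable (fun x => (a x j : ℂ)) volume :=
      Complex.continuous_ofReal.comp_aestronglyMeasurable
        ((EuclideanSpace.proj (𝕜 := ℝ) j).continuous.comp_aestronglyMeasurable ha)
    have hK : IsCompact (tsupport η) := hη.2.1
    have h1 : MemLp (fun x => (a x j : ℂ)) 2 (volume.restrict (tsupport η)) := by
      have h2 : MemLp a 2 (volume.restrict (tsupport η)) :=
        (memLp_two_iff_integrable_sq_norm ha.restrict).2 (ha2.integrableOn_isCompact hK)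
      refine h2.of_le hm.restrict (Eventually.of_forall fun x => ?_)
      rw [Complex.norm_real]
      exact PiLp.norm_apply_le (a x) j
    have h3 : MemLp ((tsupport η).indicator fun x => (a x j : ℂ)) 2 volume :=
      (memLp_indicator_iff_restrict (isClosed_tsupport η).measurableSet).2 h1
    obtain ⟨C, hC⟩ := hη.2.1.exists_bound_of_continuous hη.1.continuous
    refine (h3.norm.const_mul C).of_le (hm.mul hη.1.continuous.aestronglyMeasurable)
      (Eventually.of_forall fun x => ?_)
    by_cases hx : x ∈ tsupport η
    · rw [Set.indicator_of_mem hx, norm_mul, norm_mul, norm_norm, mul_comm]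
      gcongr
      exact (hC x).trans (le_abs_self C)
    · rw [image_eq_zero_of_notMem_tsupport hx, mul_zero, norm_zero]
      exact norm_nonneg _

/-- The defining relation of `(i∇ + a)_j` in the sense of distributions on `C₀^∞(Λ)`,
written with integrals. -/
theorem mem_magGraph_iff {Λ : Set (EuclideanSpace ℝ (Fin d))}
    {a : EuclideanSpace ℝ (Fin d) → EuclideanSpace ℝ (Fin d)}
    (ha : AEStronglyMeasurable a volume) (ha2 : LocallyIntegrable (fun x => ‖a x‖ ^ 2) volume)
    (j : Fin d) (φ χ : L2 Λ) :
    (φ, χ) ∈ magGraph Λ a j ↔ ∀ η, IsTest Λ η →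
      ∫ x in Λ, starRingEnd ℂ (φ x) *
        (Complex.I * fderiv ℝ η x (EuclideanSpace.single j 1) + (a x j : ℂ) * η x) =
      ∫ x in Λ, starRingEnd ℂ (χ x) * η x := by
  have key : ∀ η, ∀ e g : L2 Λ, e =ᵐ[volume.restrict Λ] η →
      g =ᵐ[volume.restrict Λ] covDeriv a j η →
      ⟪φ, g⟫_ℂ = ∫ x in Λ, starRingEnd ℂ (φ x) *
        (Complex.I * fderiv ℝ η x (EuclideanSpace.single j 1) + (a x j : ℂ) * η x) ∧
      ⟪χ, e⟫_ℂ = ∫ x in Λ, starRingEnd ℂ (χ x) * η x := by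
    intro η e g he hg
    rw [L2.inner_def, L2.inner_def]
    constructor
    · refine integral_congr_ae ?_
      filter_upwards [hg] with x hx
      rw [hx, RCLike.inner_apply, mul_comm]
      rfl
    · refine integral_congr_ae ?_
      filter_upwards [he] with x hx
      rw [hx, RCLike.inner_apply, mul_comm]
  constructor
  · intro h η hη
    have h1 := hη.memLp.coeFn_toLp
    have h2 := (hη.memLp_covDeriv ha ha2 j).coeFn_toLp
    rw [← (key η _ _ h1 h2).1, ← (key η _ _ h1 h2).2]
    exact h η hη _ _ h1 h2
  · intro h η hη e g he hg
    rw [(key η e g he hg).1, (key η e g he hg).2]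
    exact h η hη

/-- The operator `(i∇ + a)_j` in the sense of distributions, on its maximal domain
`{φ ∈ L²(Λ) | (i∇ + a)_j φ ∈ L²(Λ)}`. -/
noncomputable def magDeriv (Λ : Set (EuclideanSpace ℝ (Fin d)))
    (a : EuclideanSpace ℝ (Fin d) → EuclideanSpace ℝ (Fin d)) (j : Fin d) : L2 Λ →ₗ.[ℂ] L2 Λ :=
  (magGraph Λ a j).toLinearPMap

/-- On an open set `Λ` the operator `magDeriv` has the intended graph. -/
theorem mem_graph_magDeriv {Λ : Set (EuclideanSpace ℝ (Fin d))} (hΛ : IsOpen Λ)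
    {a : EuclideanSpace ℝ (Fin d) → EuclideanSpace ℝ (Fin d)}
    (ha : AEStronglyMeasurable a volume) (ha2 : LocallyIntegrable (fun x => ‖a x‖ ^ 2) volume)
    (j : Fin d) (φ χ : L2 Λ) :
    (φ, χ) ∈ (magDeriv Λ a j).graph ↔ (φ, χ) ∈ magGraph Λ a j := by
  rw [magDeriv, Submodule.toLinearPMap_graph_eq]
  rintro ⟨x, y⟩ hxy (h0 : x = 0)
  subst h0
  rw [mem_magGraph_iff ha ha2] at hxy
  have hz : ∀ η, IsTest Λ η → ∫ x in Λ, starRingEnd ℂ (y x) * η x = 0 := fun η hη => by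
    rw [← hxy η hη]
    refine integral_eq_zero_of_ae ?_
    filter_upwards [Lp.coeFn_zero ℂ 2 (volume.restrict Λ)] with z hz
    rw [hz]
    simp
  have hyc : LocallyIntegrable (fun x => starRingEnd ℂ (y x)) (volume.restrict Λ) :=
    (Lp.memLp y).star.locallyIntegrable (by norm_num)
  have key := hΛ.ae_eq_zero_of_integral_contDiff_smul_eq_zero (hyc.locallyIntegrableOn Λ)
    (fun g hg hgc hgs => by
      have hT : IsTest Λ (fun x => (g x : ℂ)) :=
        ⟨Complex.ofRealCLM.contDiff.comp hg, hgc.comp_left (g := fun r : ℝ => (r : ℂ)) (by simp),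
          (closure_mono (Function.support_comp_subset (g := fun r : ℝ => (r : ℂ)) (by simp) g)).trans
            hgs⟩
      rw [← hz _ hT]
      refine integral_congr_ae (Eventually.of_forall fun x => ?_)
      change g x • starRingEnd ℂ (y x) = starRingEnd ℂ (y x) * (g x : ℂ)
      rw [Complex.real_smul, mul_comm])
  refine Lp.ext ?_
  filter_upwards [(ae_restrict_iff' hΛ.measurableSet).2
    ((ae_restrict_iff' hΛ.measurableSet).1 key |>.mono fun x hx => hx),
    ae_restrict_mem hΛ.measurableSet, Lp.coeFn_zero ℂ 2 (volume.restrict Λ)] with x hx hxΛ hx0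
  rw [hx0, Pi.zero_apply]
  simpa using hx hxΛ

/-- The magnetic Sobolev space `W_a^{1,2}(Λ) = {φ ∈ L²(Λ) | (i∇ + a) φ ∈ L²(Λ)ᵈ}`. -/
noncomputable def magSobolev (Λ : Set (EuclideanSpace ℝ (Fin d)))
    (a : EuclideanSpace ℝ (Fin d) → EuclideanSpace ℝ (Fin d)) : Submodule ℂ (L2 Λ) :=
  ⨅ j : Fin d, (magDeriv Λ a j).domain

theorem magSobolev_le (Λ : Set (EuclideanSpace ℝ (Fin d)))
    (a : EuclideanSpace ℝ (Fin d) → EuclideanSpace ℝ (Fin d)) (j : Fin d) :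
    magSobolev Λ a ≤ (SesqForm.ofOp (magDeriv Λ a j)).dom :=
  iInf_le _ j

/-- The form `h^{a,0}_{Λ,N} (φ, ψ) = 1/2 ∑_j ⟪(i∇ + a)_j φ, (i∇ + a)_j ψ⟫` on `W_a^{1,2}(Λ)`. -/
noncomputable def kineticN (Λ : Set (EuclideanSpace ℝ (Fin d)))
    (a : EuclideanSpace ℝ (Fin d) → EuclideanSpace ℝ (Fin d)) : SesqForm (L2 Λ) where
  dom := magSobolev Λ a
  form := (1 / 2 : ℂ) • ∑ j : Fin d,
    (SesqForm.ofOp (magDeriv Λ a j)).onSubspace (magSobolev Λ a) (magSobolev_le Λ a j)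

theorem kineticN_apply (Λ : Set (EuclideanSpace ℝ (Fin d)))
    (a : EuclideanSpace ℝ (Fin d) → EuclideanSpace ℝ (Fin d)) (φ ψ : (kineticN Λ a).dom) :
    (kineticN Λ a).form φ ψ = (1 / 2 : ℂ) * ∑ j : Fin d,
      ⟪magDeriv Λ a j ⟨φ, magSobolev_le Λ a j φ.2⟩,
        magDeriv Λ a j ⟨ψ, magSobolev_le Λ a j ψ.2⟩⟫_ℂ := by
  have h : ∀ (B : Fin d → (magSobolev Λ a →ₗ⋆[ℂ] magSobolev Λ a →ₗ[ℂ] ℂ))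
      (x y : magSobolev Λ a),
      ((1 / 2 : ℂ) • ∑ j, B j) x y = (1 / 2 : ℂ) * ∑ j, B j x y := fun B x y => by
    simp [LinearMap.sum_apply]
  exact h _ φ ψ

/-- The quadratic form of `h^{a,0}_{Λ,N}` as a sum of squares. -/
theorem kineticN_self (Λ : Set (EuclideanSpace ℝ (Fin d)))
    (a : EuclideanSpace ℝ (Fin d) → EuclideanSpace ℝ (Fin d)) (φ : (kineticN Λ a).dom) :
    ((kineticN Λ a).form φ φ).re = (1 / 2 : ℝ) * ∑ j : Fin d,
      ‖magDeriv Λ a j ⟨φ, magSobolev_le Λ a j φ.2⟩‖ ^ 2 := by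
  rw [kineticN_apply]
  simp_rw [inner_self_eq_norm_sq_to_K]
  have : ∀ s : ℝ, ((1 / 2 : ℂ) * (s : ℂ)).re = 1 / 2 * s := fun s => by
    rw [show ((1 / 2 : ℂ) * (s : ℂ)) = ((1 / 2 * s : ℝ) : ℂ) by push_cast; rfl, Complex.ofReal_re]
  rw [← this]
  push_cast
  rfl

/-- The square of the form norm of `h^{a,0}_{Λ,N}`. -/
noncomputable def kineticNormSq (Λ : Set (EuclideanSpace ℝ (Fin d)))
    (a : EuclideanSpace ℝ (Fin d) → EuclideanSpace ℝ (Fin d)) (φ : (kineticN Λ a).dom) : ℝ :=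
  ‖(φ : L2 Λ)‖ ^ 2 + ((kineticN Λ a).form φ φ).re

theorem kineticNormSq_nonneg (Λ : Set (EuclideanSpace ℝ (Fin d)))
    (a : EuclideanSpace ℝ (Fin d) → EuclideanSpace ℝ (Fin d)) (φ : (kineticN Λ a).dom) :
    0 ≤ kineticNormSq Λ a φ := by
  rw [kineticNormSq, kineticN_self]
  positivity

theorem kineticNormSq_add (Λ : Set (EuclideanSpace ℝ (Fin d)))
    (a : EuclideanSpace ℝ (Fin d) → EuclideanSpace ℝ (Fin d)) (φ ψ : (kineticN Λ a).dom) :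
    kineticNormSq Λ a (φ + ψ) ≤ 2 * kineticNormSq Λ a φ + 2 * kineticNormSq Λ a ψ := by
  have h : kineticNormSq Λ a (φ + ψ) + kineticNormSq Λ a (φ - ψ) =
      2 * kineticNormSq Λ a φ + 2 * kineticNormSq Λ a ψ := by
    have hp := parallelogram_law_with_norm ℂ (φ : L2 Λ) (ψ : L2 Λ)
    simp only [kineticNormSq, Submodule.coe_add, Submodule.coe_sub]
    have hk : ((kineticN Λ a).form (φ + ψ) (φ + ψ)).re +
        ((kineticN Λ a).form (φ - ψ) (φ - ψ)).re =
        2 * ((kineticN Λ a).form φ φ).re + 2 * ((kineticN Λ a).form ψ ψ).re := by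
      simp only [map_add, map_sub, LinearMap.add_apply, LinearMap.sub_apply, Complex.add_re,
        Complex.sub_re]
      ring
    nlinarith [hp, hk]
  linarith [kineticNormSq_nonneg Λ a (φ - ψ)]

theorem kineticNormSq_smul (Λ : Set (EuclideanSpace ℝ (Fin d)))
    (a : EuclideanSpace ℝ (Fin d) → EuclideanSpace ℝ (Fin d)) (c : ℂ) (φ : (kineticN Λ a).dom) :
    kineticNormSq Λ a (c • φ) = ‖c‖ ^ 2 * kineticNormSq Λ a φ := by
  have h : ∀ j : Fin d, ‖magDeriv Λ a j ⟨(c • φ : (kineticN Λ a).dom), magSobolev_le Λ a j (c • φ).2⟩‖ ^ 2 =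
      ‖c‖ ^ 2 * ‖magDeriv Λ a j ⟨φ, magSobolev_le Λ a j φ.2⟩‖ ^ 2 := fun j => by
    rw [← mul_pow, ← norm_smul, ← LinearPMap.map_smul]
    rfl
  have hn : ‖((c • φ : (kineticN Λ a).dom) : L2 Λ)‖ = ‖c‖ * ‖(φ : L2 Λ)‖ := norm_smul c (φ : L2 Λ)
  rw [kineticNormSq, kineticNormSq, kineticN_self, kineticN_self, hn]
  simp_rw [h]
  rw [← Finset.mul_sum]
  ring

/-- The form domain of `h^{a,0}_{Λ,D}`: the closure of `C₀^∞(Λ)` in `W_a^{1,2}(Λ)` with respect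
to the form norm of `h^{a,0}_{Λ,N}`. -/
noncomputable def dirichletDomain (Λ : Set (EuclideanSpace ℝ (Fin d)))
    (a : EuclideanSpace ℝ (Fin d) → EuclideanSpace ℝ (Fin d)) : Submodule ℂ (L2 Λ) where
  carrier := {ψ | ∃ hψ : ψ ∈ (kineticN Λ a).dom, ∃ u : ℕ → (kineticN Λ a).dom,
    (∀ n, ∃ η, IsTest Λ η ∧ (u n : L2 Λ) =ᵐ[volume.restrict Λ] η) ∧
    Tendsto (fun n => kineticNormSq Λ a (u n - ⟨ψ, hψ⟩)) atTop (𝓝 0)}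
  add_mem' := by
    rintro φ ψ ⟨hφ, u, hu, hut⟩ ⟨hψ, w, hw, hwt⟩
    refine ⟨Submodule.add_mem _ hφ hψ, fun n => u n + w n, fun n => ?_, ?_⟩
    · obtain ⟨η, hη, hη'⟩ := hu n
      obtain ⟨θ, hθ, hθ'⟩ := hw n
      exact ⟨η + θ, hη.add hθ, (Lp.coeFn_add _ _).trans (hη'.add hθ')⟩
    · have hlim := (hut.const_mul 2).add (hwt.const_mul 2)
      rw [mul_zero, add_zero] at hlim
      refine squeeze_zero (fun n => kineticNormSq_nonneg Λ a _) (fun n => ?_) hlim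
      have : (u n + w n - ⟨φ + ψ, Submodule.add_mem _ hφ hψ⟩ : (kineticN Λ a).dom) =
          (u n - ⟨φ, hφ⟩) + (w n - ⟨ψ, hψ⟩) :=
        Subtype.ext (add_sub_add_comm (u n : L2 Λ) (w n) φ ψ)
      rw [this]
      exact kineticNormSq_add Λ a _ _
  zero_mem' := by
    refine ⟨Submodule.zero_mem _, fun _ => 0, fun _ => ⟨0, IsTest.zero Λ, Lp.coeFn_zero _ _ _⟩, ?_⟩
    have h0 : (0 - ⟨0, Submodule.zero_mem _⟩ : (kineticN Λ a).dom) = (0 : ℂ) • 0 :=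
      Subtype.ext (by simp)
    simp only [h0, kineticNormSq_smul]
    simp
  smul_mem' := by
    rintro c φ ⟨hφ, u, hu, hut⟩
    refine ⟨Submodule.smul_mem _ c hφ, fun n => c • u n, fun n => ?_, ?_⟩
    · obtain ⟨η, hη, hη'⟩ := hu n
      exact ⟨c • η, hη.smul c, (Lp.coeFn_smul _ _).trans (hη'.const_smul c)⟩
    · have hlim := hut.const_mul (‖c‖ ^ 2)
      rw [mul_zero] at hlim
      refine hlim.congr fun n => ?_
      rw [← kineticNormSq_smul]
      congr 1
      exact Subtype.ext (smul_sub c (u n : L2 Λ) φ)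

theorem dirichletDomain_le (Λ : Set (EuclideanSpace ℝ (Fin d)))
    (a : EuclideanSpace ℝ (Fin d) → EuclideanSpace ℝ (Fin d)) :
    dirichletDomain Λ a ≤ (kineticN Λ a).dom :=
  fun _ h => h.1

/-- The boundary condition: Dirichlet or Neumann. -/
inductive BC
  | D
  | N

/-- The form `h^{a,0}_{Λ,X}` for `X = D, N`. -/
noncomputable def kinetic (X : BC) (Λ : Set (EuclideanSpace ℝ (Fin d)))
    (a : EuclideanSpace ℝ (Fin d) → EuclideanSpace ℝ (Fin d)) : SesqForm (L2 Λ) :=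
  match X with
  | BC.D => (kineticN Λ a).restrict (dirichletDomain Λ a) (dirichletDomain_le Λ a)
  | BC.N => kineticN Λ a

/-- The graph of multiplication by `w` in `L²(Λ)`. -/
def mulGraph (Λ : Set (EuclideanSpace ℝ (Fin d))) (w : EuclideanSpace ℝ (Fin d) → ℝ) :
    Submodule ℂ (L2 Λ × L2 Λ) where
  carrier := {x | x.2 =ᵐ[volume.restrict Λ] fun y => (w y : ℂ) * x.1 y}
  add_mem' := fun {x y} hx hy => by
    change (x + y).2 =ᵐ[volume.restrict Λ] fun z => (w z : ℂ) * (x + y).1 z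
    filter_upwards [hx, hy, Lp.coeFn_add x.1 y.1, Lp.coeFn_add x.2 y.2] with z h1 h2 h3 h4
    rw [Prod.fst_add, Prod.snd_add, h3, h4, Pi.add_apply, Pi.add_apply, h1, h2, mul_add]
  zero_mem' := by
    change (0 : L2 Λ × L2 Λ).2 =ᵐ[volume.restrict Λ] fun z => (w z : ℂ) * (0 : L2 Λ × L2 Λ).1 z
    filter_upwards [Lp.coeFn_zero ℂ 2 (volume.restrict Λ)] with z h1
    rw [Prod.fst_zero, Prod.snd_zero, h1, Pi.zero_apply, mul_zero]
  smul_mem' := fun c x hx => by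
    change (c • x).2 =ᵐ[volume.restrict Λ] fun z => (w z : ℂ) * (c • x).1 z
    filter_upwards [hx, Lp.coeFn_smul c x.1, Lp.coeFn_smul c x.2] with z h1 h2 h3
    rw [Prod.smul_fst, Prod.smul_snd, h2, h3, Pi.smul_apply, Pi.smul_apply, h1, smul_eq_mul,
      smul_eq_mul, mul_left_comm]

/-- Multiplication by `w` in `L²(Λ)`, on its maximal domain `{φ ∈ L²(Λ) | w φ ∈ L²(Λ)}`. -/
noncomputable def mulOp (Λ : Set (EuclideanSpace ℝ (Fin d)))
    (w : EuclideanSpace ℝ (Fin d) → ℝ) : L2 Λ →ₗ.[ℂ] L2 Λ :=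
  (mulGraph Λ w).toLinearPMap

theorem mem_graph_mulOp {Λ : Set (EuclideanSpace ℝ (Fin d))}
    {w : EuclideanSpace ℝ (Fin d) → ℝ} (φ χ : L2 Λ) :
    (φ, χ) ∈ (mulOp Λ w).graph ↔ χ =ᵐ[volume.restrict Λ] fun y => (w y : ℂ) * φ y := by
  rw [mulOp, Submodule.toLinearPMap_graph_eq]
  · rfl
  · rintro ⟨x, y⟩ (hxy : y =ᵐ[volume.restrict Λ] fun z => (w z : ℂ) * x z) (h0 : x = 0)
    subst h0
    refine Lp.ext ?_
    filter_upwards [hxy, Lp.coeFn_zero ℂ 2 (volume.restrict Λ)] with z h1 h2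
    rw [h1, h2, Pi.zero_apply, mul_zero]

/-- The form `(φ, ψ) ↦ ⟪w^{1/2} φ, w^{1/2} ψ⟫` of a non-negative function `w`, with form domain
`Q(w) = {φ ∈ L²(Λ) | w^{1/2} φ ∈ L²(Λ)}`. -/
noncomputable def potentialForm (Λ : Set (EuclideanSpace ℝ (Fin d)))
    (w : EuclideanSpace ℝ (Fin d) → ℝ) : SesqForm (L2 Λ) :=
  SesqForm.ofOp (mulOp Λ fun x => Real.sqrt (w x))

/-- The positive part `v₊ = (|v| + v) / 2`. -/
noncomputable def vPos (v : EuclideanSpace ℝ (Fin d) → ℝ) : EuclideanSpace ℝ (Fin d) → ℝ :=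
  fun x => (|v x| + v x) / 2

/-- The negative part `v₋ = (|v| - v) / 2`. -/
noncomputable def vNeg (v : EuclideanSpace ℝ (Fin d) → ℝ) : EuclideanSpace ℝ (Fin d) → ℝ :=
  fun x => (|v x| - v x) / 2

/-- The form `h^{a,v}_{Λ,X} = h^{a,0}_{Λ,X} + v₊ - v₋`. Its form domain is
`Q(h^{a,0}_{Λ,X}) ∩ Q(v₊)` whenever `v₋` is a form perturbation of `h^{a,0}_{Λ,X}`,
see `magForm_dom`. -/
noncomputable def magForm (X : BC) (Λ : Set (EuclideanSpace ℝ (Fin d)))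
    (a : EuclideanSpace ℝ (Fin d) → EuclideanSpace ℝ (Fin d))
    (v : EuclideanSpace ℝ (Fin d) → ℝ) : SesqForm (L2 Λ) :=
  ((kinetic X Λ a).add (potentialForm Λ (vPos v))).sub (potentialForm Λ (vNeg v))

theorem magForm_dom {X : BC} {Λ : Set (EuclideanSpace ℝ (Fin d))}
    {a : EuclideanSpace ℝ (Fin d) → EuclideanSpace ℝ (Fin d)}
    {v : EuclideanSpace ℝ (Fin d) → ℝ}
    (h : SesqForm.IsFormPerturbation (potentialForm Λ (vNeg v)) (kinetic X Λ a)) :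
    (magForm X Λ a v).dom = (kinetic X Λ a).dom ⊓ (potentialForm Λ (vPos v)).dom :=
  inf_eq_left.2 (inf_le_left.trans h.1)

/-- The magnetic Schrödinger operator `H_{Λ,X}(a, v)` on `L²(Λ)`. -/
noncomputable def magOp (X : BC) (Λ : Set (EuclideanSpace ℝ (Fin d)))
    (a : EuclideanSpace ℝ (Fin d) → EuclideanSpace ℝ (Fin d))
    (v : EuclideanSpace ℝ (Fin d) → ℝ) : L2 Λ →ₗ.[ℂ] L2 Λ :=
  (magForm X Λ a v).operator

/-- `H_{Λ,X}(a, v)` is well defined: `v₋` is a form perturbation of `H_{Λ,X}(a, 0)`, the form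
`h^{a,v}_{Λ,X}` is densely defined, symmetric, bounded below and closed, and `H_{Λ,X}(a, v)` is
self-adjoint. -/
def MagOpDefined (X : BC) (Λ : Set (EuclideanSpace ℝ (Fin d)))
    (a : EuclideanSpace ℝ (Fin d) → EuclideanSpace ℝ (Fin d))
    (v : EuclideanSpace ℝ (Fin d) → ℝ) : Prop :=
  SesqForm.IsFormPerturbation (potentialForm Λ (vNeg v)) (kinetic X Λ a) ∧
  (magForm X Λ a v).IsClosedSemibounded ∧ IsSelfAdjoint (magOp X Λ a v)

theorem subset_interior_closure {Λ₁ Λ₂ : Set (EuclideanSpace ℝ (Fin d))}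
    (h₁ : IsOpen Λ₁) (h₂ : IsOpen Λ₂) : Λ₁ ∪ Λ₂ ⊆ interior (closure (Λ₁ ∪ Λ₂)) :=
  interior_maximal subset_closure (h₁.union h₂)

end Magnetic

end MagSchr

open MagSchr

/-! The whole argument takes place at the level of forms.

Abstract part. Let `q` be densely defined, symmetric, closed and bounded below by `m`. Then `q`
shifted by `1 - m` is a complete inner product on the form domain, so Riesz representation makes `H
+ (1 - m)` surjective. A symmetric operator with this property is self-adjoint
(`IsClosedSemibounded.isSelfAdjoint_operator`). If `k` and `p` are closed and positive and `w` is
bounded by `k` with relative bound `α < 1`, then `k + p - w` controls `k + p` up to a multiple of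
the norm, so it is closed too (`IsClosedNonneg.isClosedSemibounded_sub`). Here closedness of `k` and
`p` comes from closed graphs of distributional derivatives and of multiplication operators, and
density comes from the test functions.

Decoupling. A test function on a disjoint union of two open sets is the sum of its two cut-offs,
each of which is again a test function (`IsTest.indicator`). Hence the derivatives, the Sobolev
space, the closure of the test functions and the potentials all split, and an orthogonal sum of
forms has the orthogonal sum of the operators (`SplitsVia.eqVia_operator`).

Bracketing. Along the chain of inequalities the value of the form never changes; only the form
domain shrinks. There are fewer test functions on `Λ₁ ∪ Λ₂` than on `Λ`. This weakens the condition
defining the Neumann domain, which grows, and leaves less to take the closure of, so the Dirichlet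
domain shrinks. The Neumann form on `Λ₁ ∪ Λ₂` therefore has the largest domain, and the form bound
assumed there passes to all other forms with the same constants (`IsFormPerturbation.of_embeds`). -/

namespace MagSchr

/-! ### Closed forms and their operators -/

section AbstractForms

variable {E : Type*} [NormedAddCommGroup E] [InnerProductSpace ℂ E]
variable {F : Type*} [NormedAddCommGroup F] [InnerProductSpace ℂ F]

/-- The Riesz representation theorem for an inner product given by a `Core` that is complete in
the sense of sequences. -/
theorem exists_core_inner_eq {H : Type*} [AddCommGroup H] [Module ℂ H]
    (c : InnerProductSpace.Core ℂ H)
    (hc : ∀ u : ℕ → H, Tendsto (fun p : ℕ × ℕ =>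
      (c.inner (u p.1 - u p.2) (u p.1 - u p.2)).re) atTop (𝓝 0) →
      ∃ x, Tendsto (fun n => (c.inner (u n - x) (u n - x)).re) atTop (𝓝 0))
    (l : H →ₗ[ℂ] ℂ) (C : ℝ) (hl : ∀ x, ‖l x‖ ^ 2 ≤ C ^ 2 * (c.inner x x).re) :
    ∃ y, ∀ x, c.inner y x = l x := by
  let : NormedAddCommGroup H := c.toNormedAddCommGroup
  let : InnerProductSpace ℂ H := InnerProductSpace.ofCore c.toCore
  have hsq : ∀ x : H, ‖x‖ ^ 2 = (c.inner x x).re := fun x =>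
    InnerProductSpace.norm_sq_eq_re_inner (𝕜 := ℂ) x
  have : CompleteSpace H := by
    refine Metric.complete_of_cauchySeq_tendsto fun u hu => ?_
    rw [cauchySeq_iff_tendsto_dist_atTop_0] at hu
    obtain ⟨x, hx⟩ := hc u (by
      simp_rw [← hsq]
      simpa [dist_eq_norm] using hu.pow 2)
    refine ⟨x, tendsto_iff_norm_sub_tendsto_zero.2 ?_⟩
    simp_rw [← hsq] at hx
    simpa [Real.sqrt_sq] using hx.sqrt
  -- The bound involves only `C ^ 2`, so `C` may be negative; `|C|` is an admissible operator bound.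
  let L : H →L[ℂ] ℂ := l.mkContinuous |C| fun x => by
    refine abs_le_of_sq_le_sq' ?_ (by positivity) |>.2
    rw [mul_pow, sq_abs, hsq]
    exact hl x
  refine ⟨(InnerProductSpace.toDual ℂ H).symm L, fun x => ?_⟩
  exact InnerProductSpace.toDual_symm_apply (𝕜 := ℂ) (x := x) (y := L)

namespace SesqForm

/-- The quadratic form of a sesquilinear form. -/
noncomputable abbrev quad (q : SesqForm E) (φ : q.dom) : ℝ := (q.form φ φ).re

/-- A form is symmetric, positive and closed. -/
structure IsClosedNonneg (q : SesqForm E) : Prop where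
  symmetric : ∀ φ ψ : q.dom, q.form ψ φ = starRingEnd ℂ (q.form φ ψ)
  nonneg : ∀ φ : q.dom, 0 ≤ q.quad φ
  closed : ∀ (u : ℕ → q.dom) (φ : E), Tendsto (fun n => (u n : E)) atTop (𝓝 φ) →
    Tendsto (fun p : ℕ × ℕ => q.quad (u p.1 - u p.2)) atTop (𝓝 0) →
    ∃ hφ : φ ∈ q.dom, Tendsto (fun n => q.quad (u n - ⟨φ, hφ⟩)) atTop (𝓝 0)

theorem form_self_eq_quad {q : SesqForm E}
    (hq : ∀ φ ψ : q.dom, q.form ψ φ = starRingEnd ℂ (q.form φ ψ)) (φ : q.dom) :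
    q.form φ φ = (q.quad φ : ℂ) :=
  (Complex.conj_eq_iff_re.1 (hq φ φ).symm).symm

/-- Passes between `IsClosedSemibounded`, which speaks of complex values, and `IsClosedNonneg`,
which speaks of real parts: the diagonal of a symmetric form is real. -/
theorem tendsto_form_self_iff {q : SesqForm E}
    (hq : ∀ φ ψ : q.dom, q.form ψ φ = starRingEnd ℂ (q.form φ ψ)) {ι : Type*} {l : Filter ι}
    (f : ι → q.dom) :
    Tendsto (fun i => q.form (f i) (f i)) l (𝓝 0) ↔ Tendsto (fun i => q.quad (f i)) l (𝓝 0) := by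
  simp_rw [form_self_eq_quad hq]
  constructor
  · intro h
    have := (Complex.continuous_re.tendsto 0).comp h
    simpa [Function.comp_def] using this
  · intro h
    exact (Complex.continuous_ofReal.tendsto 0).comp h

/-! ### The first representation theorem -/

section Representation

theorem mem_graph_operator_iff {q : SesqForm E} (hq : Dense (q.dom : Set E)) (ψ χ : E) :
    (∃ h : ψ ∈ q.operator.domain, q.operator ⟨ψ, h⟩ = χ) ↔
      ∃ hψ : ψ ∈ q.dom, ∀ φ : q.dom, q.form φ ⟨ψ, hψ⟩ = ⟪(φ : E), χ⟫_ℂ := by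
  rw [← mem_graph_operator q hq, LinearPMap.mem_graph_iff]
  constructor
  · rintro ⟨h, h'⟩
    exact ⟨⟨ψ, h⟩, rfl, h'⟩
  · rintro ⟨⟨x, h⟩, rfl, h'⟩
    exact ⟨h, h'⟩

theorem operator_spec {q : SesqForm E} (hq : Dense (q.dom : Set E)) (ψ : q.operator.domain) :
    ∃ hψ : (ψ : E) ∈ q.dom, ∀ φ : q.dom, q.form φ ⟨ψ, hψ⟩ = ⟪(φ : E), q.operator ψ⟫_ℂ :=
  (mem_graph_operator_iff hq _ _).1 ⟨ψ.2, rfl⟩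

variable [CompleteSpace E]

/-- The first representation theorem, in the form: `H + (1 - m)` is onto if `m` is a lower bound
of the form. -/
theorem IsClosedSemibounded.exists_form_add_inner_eq {q : SesqForm E}
    (hq : q.IsClosedSemibounded) {m : ℝ}
    (hm : ∀ φ : q.dom, m * ‖(φ : E)‖ ^ 2 ≤ (q.form φ φ).re) (χ : E) :
    ∃ ψ : q.dom, ∀ φ : q.dom,
      q.form φ ψ + ((1 - m : ℝ) : ℂ) * ⟪(φ : E), (ψ : E)⟫_ℂ = ⟪(φ : E), χ⟫_ℂ := by
  have hself : ∀ x : E, ⟪x, x⟫_ℂ = ((‖x‖ ^ 2 : ℝ) : ℂ) := fun x => by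
    rw [inner_self_eq_norm_sq_to_K]; norm_cast
  -- The shift by `1 - m` makes the form dominate the square of the norm of `E`. This gives
  -- definiteness, boundedness of `φ ↦ ⟪χ, φ⟫`, and convergence in `E` of sequences that are Cauchy
  -- for the new inner product.
  have hle : ∀ φ : q.dom, ‖(φ : E)‖ ^ 2 ≤
      (q.form φ φ + ((1 - m : ℝ) : ℂ) * ⟪(φ : E), (φ : E)⟫_ℂ).re := fun φ => by
    rw [hself, Complex.add_re, ← Complex.ofReal_mul, Complex.ofReal_re]
    linarith [hm φ]
  let c : InnerProductSpace.Core ℂ q.dom :=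
    { inner := fun φ ψ => q.form φ ψ + ((1 - m : ℝ) : ℂ) * ⟪(φ : E), (ψ : E)⟫_ℂ
      conj_inner_symm := fun φ ψ => by
        rw [map_add, map_mul, Complex.conj_ofReal, inner_conj_symm, ← hq.symmetric]
      re_inner_nonneg := fun φ => (sq_nonneg _).trans (hle φ)
      add_left := fun φ ψ θ => by
        rw [map_add, LinearMap.add_apply, Submodule.coe_add, inner_add_left]; ring
      smul_left := fun φ ψ r => by
        rw [LinearMap.map_smulₛₗ, LinearMap.smul_apply, Submodule.coe_smul, inner_smul_left,
          smul_eq_mul]; ring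
      definite := fun φ h => by
        have := hle φ
        rw [h, Complex.zero_re] at this
        exact Subtype.ext (norm_eq_zero.1 (pow_eq_zero_iff two_ne_zero |>.1
          (le_antisymm this (sq_nonneg _)))) }
  obtain ⟨ψ, hψ⟩ := exists_core_inner_eq c (fun u hu => by
      have h1 : Tendsto (fun p : ℕ × ℕ => ‖(u p.1 : E) - u p.2‖ ^ 2) atTop (𝓝 0) :=
        squeeze_zero (fun _ => sq_nonneg _) (fun p => hle (u p.1 - u p.2)) hu
      have h2 : CauchySeq fun n => (u n : E) := by
        rw [cauchySeq_iff_tendsto_dist_atTop_0]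
        simpa [dist_eq_norm, Real.sqrt_sq] using h1.sqrt
      obtain ⟨φ, hφ⟩ := cauchySeq_tendsto_of_complete h2
      have key : ∀ θ : q.dom, (q.form θ θ).re =
          (c.inner θ θ).re - (1 - m) * ‖(θ : E)‖ ^ 2 := fun θ => by
        change _ = (q.form θ θ + ((1 - m : ℝ) : ℂ) * ⟪(θ : E), (θ : E)⟫_ℂ).re - _
        rw [hself, Complex.add_re, ← Complex.ofReal_mul, Complex.ofReal_re]
        ring
      -- Removing the shift, which tends to zero because the sequence is Cauchy in `E`, leaves the
      -- Cauchy condition for `q` itself, to which closedness applies.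
      have h3 := hu.sub (h1.const_mul (1 - m))
      rw [mul_zero, sub_zero] at h3
      obtain ⟨hφd, hlim⟩ := hq.closed u φ hφ (by
        rw [tendsto_form_self_iff hq.symmetric (fun p : ℕ × ℕ => u p.1 - u p.2)]
        refine h3.congr fun p => ?_
        rw [quad, key]
        rfl)
      rw [tendsto_form_self_iff hq.symmetric (fun n => u n - ⟨φ, hφd⟩)] at hlim
      refine ⟨⟨φ, hφd⟩, ?_⟩
      have h4 : Tendsto (fun n => ‖(u n : E) - φ‖ ^ 2) atTop (𝓝 0) := by
        simpa using (tendsto_iff_norm_sub_tendsto_zero.1 hφ).pow 2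
      have h5 := hlim.add (h4.const_mul (1 - m))
      rw [mul_zero, add_zero] at h5
      refine h5.congr fun n => ?_
      rw [quad, key]
      exact sub_add_cancel _ _)
    ((innerₛₗ ℂ χ).comp q.dom.subtype) ‖χ‖ (fun φ => by
      have h1 : ‖⟪χ, (φ : E)⟫_ℂ‖ ≤ ‖χ‖ * ‖(φ : E)‖ := norm_inner_le_norm _ _
      calc ‖⟪χ, (φ : E)⟫_ℂ‖ ^ 2 ≤ (‖χ‖ * ‖(φ : E)‖) ^ 2 := by gcongr
        _ = ‖χ‖ ^ 2 * ‖(φ : E)‖ ^ 2 := mul_pow _ _ _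
        _ ≤ ‖χ‖ ^ 2 * (c.inner φ φ).re := by gcongr; exact hle φ)
  refine ⟨ψ, fun φ => ?_⟩
  -- Riesz puts the representing vector in the first slot, whereas the weak equation has it in the
  -- second; conjugation exchanges them.
  have h := congrArg (starRingEnd ℂ) (hψ φ)
  change starRingEnd ℂ (q.form ψ φ + ((1 - m : ℝ) : ℂ) * ⟪(ψ : E), (φ : E)⟫_ℂ) =
    starRingEnd ℂ ⟪χ, (φ : E)⟫_ℂ at h
  rwa [map_add, map_mul, Complex.conj_ofReal, inner_conj_symm, inner_conj_symm,
    ← hq.symmetric] at h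

/-- The operator of a densely defined, symmetric, semibounded, closed form is self-adjoint. -/
theorem IsClosedSemibounded.isSelfAdjoint_operator {q : SesqForm E}
    (hq : q.IsClosedSemibounded) : IsSelfAdjoint q.operator := by
  obtain ⟨m, hm⟩ := hq.bounded_below
  have hsurj : ∀ χ : E, ∃ ψ : q.operator.domain,
      q.operator ψ + ((1 - m : ℝ) : ℂ) • (ψ : E) = χ := by
    intro χ
    obtain ⟨ψ, hψ⟩ := hq.exists_form_add_inner_eq hm χ
    obtain ⟨h, h'⟩ := (mem_graph_operator_iff hq.dense (ψ : E)
      (χ - ((1 - m : ℝ) : ℂ) • (ψ : E))).2 ⟨ψ.2, fun φ => by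
        rw [inner_sub_right, inner_smul_right, ← hψ φ, add_sub_cancel_right]⟩
    exact ⟨⟨ψ, h⟩, by rw [h', sub_add_cancel]⟩
  have hsymm : q.operator.IsFormalAdjoint q.operator := by
    intro x y
    obtain ⟨hx, hx'⟩ := operator_spec hq.dense x
    obtain ⟨hy, hy'⟩ := operator_spec hq.dense y
    rw [← hy' ⟨x, hx⟩, hq.symmetric ⟨y, hy⟩ ⟨x, hx⟩, hx' ⟨y, hy⟩, inner_conj_symm]
  -- If `w` is orthogonal to the domain, write `w = (H + 1 - m) u`. Then `0 = Re ⟪u, w⟫ ≥ ‖u‖ ^ 2`,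
  -- so `u = 0` and `w = 0`.
  have hdense : Dense (q.operator.domain : Set E) := by
    rw [Submodule.dense_iff_topologicalClosure_eq_top, Submodule.topologicalClosure_eq_top_iff,
      Submodule.eq_bot_iff]
    intro w hw
    obtain ⟨u, hu⟩ := hsurj w
    have h0 : ⟪(u : E), w⟫_ℂ = 0 := (Submodule.mem_orthogonal _ _).1 hw u u.2
    obtain ⟨hud, hu'⟩ := operator_spec hq.dense u
    have h1 : (⟪(u : E), w⟫_ℂ).re = (q.form ⟨u, hud⟩ ⟨u, hud⟩).re + (1 - m) * ‖(u : E)‖ ^ 2 := by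
      rw [← hu, inner_add_right, inner_smul_right, ← hu' ⟨u, hud⟩, inner_self_eq_norm_sq_to_K,
        Complex.add_re, Complex.re_ofReal_mul]
      norm_cast
    rw [h0, Complex.zero_re] at h1
    have h2 := hm ⟨u, hud⟩
    have h3 : u = 0 := Subtype.ext (norm_eq_zero.1 (pow_eq_zero_iff two_ne_zero |>.1
      (le_antisymm (by simp only at h2; linarith) (sq_nonneg _))))
    rw [← hu, h3]
    simp
  rw [LinearPMap.isSelfAdjoint_def]
  refine le_antisymm ?_ (hsymm.le_adjoint hdense)
  have hadj := LinearPMap.adjoint_isFormalAdjoint hdense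
  have hdom : ∀ y : q.operator.adjoint.domain, ∃ h : (y : E) ∈ q.operator.domain,
      q.operator ⟨y, h⟩ = q.operator.adjoint y := by
    intro y
    -- For `y` in the domain of the adjoint, choose `u` in the domain of `H` with `(H + 1 - m) u =
    -- (H* + 1 - m) y`. Then `u - y` is orthogonal to the range of `H + 1 - m`, which is everything,
    -- so `y = u`.
    obtain ⟨u, hu⟩ := hsurj (q.operator.adjoint y + ((1 - m : ℝ) : ℂ) • (y : E))
    have huy : (u : E) = y := by
      refine ext_inner_right ℂ fun z => ?_
      obtain ⟨w, rfl⟩ := hsurj z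
      have h1 := hsymm u w
      have h2 := hadj y w
      have h3 : ⟪q.operator u + ((1 - m : ℝ) : ℂ) • (u : E), (w : E)⟫_ℂ =
        ⟪q.operator.adjoint y + ((1 - m : ℝ) : ℂ) • (y : E), (w : E)⟫_ℂ := by rw [hu]
      simp only [inner_add_left, inner_add_right, inner_smul_left, inner_smul_right,
        Complex.conj_ofReal] at h3 ⊢
      rw [← h1, ← h2, h3]
    refine ⟨huy ▸ u.2, ?_⟩
    have : (⟨y, huy ▸ u.2⟩ : q.operator.domain) = u := Subtype.ext huy.symm
    rw [this]
    rw [huy] at hu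
    exact add_right_cancel hu
  refine ⟨fun y hy => (hdom ⟨y, hy⟩).1, fun y x hyx => ?_⟩
  obtain ⟨h, h'⟩ := hdom y
  rw [← h']
  congr 1
  exact Subtype.ext hyx

end Representation

/-! ### Closedness of sums and of perturbed forms -/

section Closedness

/-- By positivity each form is dominated by the sum, so a sequence that is Cauchy for the sum is
Cauchy for both; the two limits agree because both are the limit in `E`. -/
theorem IsClosedNonneg.add {p q : SesqForm E} (hp : p.IsClosedNonneg)
    (hq : q.IsClosedNonneg) : (p.add q).IsClosedNonneg where
  symmetric φ ψ := by
    change p.form _ _ + q.form _ _ = starRingEnd ℂ (p.form _ _ + q.form _ _)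
    rw [map_add, hp.symmetric, hq.symmetric]
  nonneg φ := add_nonneg (hp.nonneg ⟨φ, φ.2.1⟩) (hq.nonneg ⟨φ, φ.2.2⟩)
  closed u φ hu hq' := by
    have hsum : Tendsto (fun r : ℕ × ℕ => p.quad (⟨u r.1, (u r.1).2.1⟩ - ⟨u r.2, (u r.2).2.1⟩) +
      q.quad (⟨u r.1, (u r.1).2.2⟩ - ⟨u r.2, (u r.2).2.2⟩)) atTop (𝓝 0) := hq'
    obtain ⟨h1, h1'⟩ := hp.closed (fun n => ⟨u n, (u n).2.1⟩) φ hu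
      (squeeze_zero (fun _ => hp.nonneg _) (fun _ => le_add_of_nonneg_right (hq.nonneg _)) hsum)
    obtain ⟨h2, h2'⟩ := hq.closed (fun n => ⟨u n, (u n).2.2⟩) φ hu
      (squeeze_zero (fun _ => hq.nonneg _) (fun _ => le_add_of_nonneg_left (hp.nonneg _)) hsum)
    refine ⟨⟨h1, h2⟩, ?_⟩
    have := h1'.add h2'
    rw [add_zero] at this
    exact this

/-- The form of a closed operator is closed. -/
theorem isClosedNonneg_ofOp [CompleteSpace F] {T : E →ₗ.[ℂ] F}
    (hT : IsClosed (T.graph : Set (E × F))) : (ofOp T).IsClosedNonneg := by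
  have hquad : ∀ φ : (ofOp T).dom, (ofOp T).quad φ = ‖T φ‖ ^ 2 := fun φ =>
    (norm_sq_eq_re_inner (𝕜 := ℂ) (T φ)).symm
  refine ⟨fun φ ψ => (inner_conj_symm (T ψ) (T φ)).symm,
    fun φ => by rw [hquad]; positivity, fun u φ hu hc => ?_⟩
  have h1 : CauchySeq fun n => T (u n) := by
    rw [cauchySeq_iff_tendsto_dist_atTop_0]
    have := hc.sqrt
    simp_rw [hquad] at this
    simp only [Real.sqrt_sq (norm_nonneg _), Real.sqrt_zero] at this
    refine this.congr fun p => ?_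
    rw [dist_eq_norm]
    exact congrArg norm (LinearPMap.map_sub T (u p.1) (u p.2))
  obtain ⟨χ, hχ⟩ := cauchySeq_tendsto_of_complete h1
  have hmem : (φ, χ) ∈ T.graph :=
    hT.mem_of_tendsto (hu.prodMk_nhds hχ) (Eventually.of_forall fun n => T.mem_graph (u n))
  obtain ⟨y, rfl, rfl⟩ : ∃ y : T.domain, (y : E) = φ ∧ T y = χ :=
    (LinearPMap.mem_graph_iff T).1 hmem
  refine ⟨y.2, ?_⟩
  simp_rw [hquad]
  have := (tendsto_iff_norm_sub_tendsto_zero.1 hχ).pow 2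
  rw [zero_pow two_ne_zero] at this
  refine this.congr fun n => ?_
  exact congrArg (‖·‖ ^ 2) (LinearPMap.map_sub T (u n) y).symm

/-- A form perturbation of a closed positive form can be subtracted. -/
theorem IsClosedNonneg.isClosedSemibounded_sub {k p w : SesqForm E} (hk : k.IsClosedNonneg)
    (hp : p.IsClosedNonneg)
    (hw : ∀ φ ψ : w.dom, w.form ψ φ = starRingEnd ℂ (w.form φ ψ)) (hpert : w.IsFormPerturbation k)
    (hdense : Dense (((k.add p).sub w).dom : Set E)) :
    ((k.add p).sub w).IsClosedSemibounded := by
  have hkp := hk.add hp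
  obtain ⟨hdom, α, β, hα0, hα1, hb⟩ := hpert
  have hdom' : (k.add p).dom ≤ w.dom := inf_le_left.trans hdom
  have hbound : ∀ φ : (k.add p).dom, |w.quad ⟨φ, hdom' φ.2⟩| ≤
      α * (k.add p).quad φ + |β| * ‖(φ : E)‖ ^ 2 := fun φ => by
    refine (Complex.abs_re_le_norm _).trans ((hb ⟨φ, φ.2.1⟩).trans ?_)
    have h1 : (k.form ⟨φ, φ.2.1⟩ ⟨φ, φ.2.1⟩).re ≤ (k.add p).quad φ :=
      le_add_of_nonneg_right (hp.nonneg ⟨φ, φ.2.2⟩)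
    exact add_le_add (mul_le_mul_of_nonneg_left h1 hα0)
      (mul_le_mul_of_nonneg_right (le_abs_self β) (sq_nonneg _))
  have hquad : ∀ φ : ((k.add p).sub w).dom, ((k.add p).sub w).quad φ =
      (k.add p).quad ⟨φ, φ.2.1⟩ - w.quad ⟨φ, φ.2.2⟩ := fun φ => rfl
  have hsymm : ∀ φ ψ : ((k.add p).sub w).dom,
      ((k.add p).sub w).form ψ φ = starRingEnd ℂ (((k.add p).sub w).form φ ψ) := fun φ ψ => by
    change (k.add p).form _ _ - w.form _ _ = starRingEnd ℂ ((k.add p).form _ _ - w.form _ _)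
    rw [map_sub, hkp.symmetric, hw]
  refine ⟨hdense, hsymm, ⟨-|β|, fun φ => ?_⟩, fun u φ hu hc => ?_⟩
  · have h1 := (abs_le.1 (hbound ⟨φ, φ.2.1⟩)).2
    have h2 := hkp.nonneg ⟨φ, φ.2.1⟩
    have h3 := hquad φ
    simp only [quad] at h1 h2 h3
    rw [h3]
    nlinarith
  · rw [tendsto_form_self_iff hsymm (fun p : ℕ × ℕ => u p.1 - u p.2)] at hc
    have hcau : Tendsto (fun r : ℕ × ℕ => ‖(u r.1 : E) - u r.2‖ ^ 2) atTop (𝓝 0) := by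
      have := (cauchySeq_iff_tendsto_dist_atTop_0.1 hu.cauchySeq).pow 2
      simpa [dist_eq_norm] using this
    -- The form bound gives `(1 - α) (k + p) ≤ (k + p - w) + |β| ‖·‖ ^ 2`. As `α < 1`, the sequence
    -- is Cauchy for `k + p`.
    have h1 := (hc.add (hcau.const_mul |β|)).const_mul (1 - α)⁻¹
    rw [mul_zero, add_zero, mul_zero] at h1
    obtain ⟨hφ, hlim⟩ := hkp.closed (fun n => ⟨u n, (u n).2.1⟩) φ hu
      (squeeze_zero (fun _ => hkp.nonneg _) (fun r => by
        rw [le_inv_mul_iff₀ (by linarith)]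
        have h2 := (abs_le.1 (hbound (⟨u r.1, (u r.1).2.1⟩ - ⟨u r.2, (u r.2).2.1⟩))).2
        have h3 : ((k.add p).sub w).quad (u r.1 - u r.2) =
          (k.add p).quad (⟨u r.1, (u r.1).2.1⟩ - ⟨u r.2, (u r.2).2.1⟩) -
          w.quad ⟨_, hdom' ((⟨u r.1, (u r.1).2.1⟩ - ⟨u r.2, (u r.2).2.1⟩ : (k.add p).dom)).2⟩ :=
          rfl
        rw [h3]
        simp only [Submodule.coe_sub] at h2 ⊢
        linarith) h1)
    refine ⟨⟨hφ, hdom' hφ⟩, ?_⟩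
    rw [tendsto_form_self_iff hsymm (fun n => u n - ⟨φ, ⟨hφ, hdom' hφ⟩⟩)]
    have h4 : Tendsto (fun n => ‖(u n : E) - φ‖ ^ 2) atTop (𝓝 0) := by
      simpa using (tendsto_iff_norm_sub_tendsto_zero.1 hu).pow 2
    have h5 := (hlim.const_mul α).add (h4.const_mul |β|)
    rw [mul_zero, mul_zero, add_zero] at h5
    -- Convergence for `k + p` and in `E` forces convergence for `w`, again by the form bound.
    have h6 : Tendsto (fun n => w.quad (⟨u n, (u n).2.2⟩ - ⟨φ, hdom' hφ⟩)) atTop (𝓝 0) :=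
      squeeze_zero_norm (fun n => hbound (⟨u n, (u n).2.1⟩ - ⟨φ, hφ⟩)) h5
    have h7 := hlim.sub h6
    rw [sub_zero] at h7
    exact h7

end Closedness

end SesqForm

end AbstractForms

/-! ### Forms under isometries and orthogonal sums -/

section Comparison

variable {E : Type*} [NormedAddCommGroup E] [InnerProductSpace ℂ E]
variable {F : Type*} [NormedAddCommGroup F] [InnerProductSpace ℂ F]
variable {G : Type*} [NormedAddCommGroup G] [InnerProductSpace ℂ G]

theorem mem_graph_orthSum (A : F →ₗ.[ℂ] F) (B : G →ₗ.[ℂ] G) (x y : WithLp 2 (F × G)) :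
    (x, y) ∈ (orthSum A B).graph ↔
      (x.fst, y.fst) ∈ A.graph ∧ (x.snd, y.snd) ∈ B.graph := by
  simp only [LinearPMap.mem_graph_iff]
  constructor
  · rintro ⟨z, rfl, rfl⟩
    exact ⟨⟨⟨_, z.2.1⟩, rfl, rfl⟩, ⟨⟨_, z.2.2⟩, rfl, rfl⟩⟩
  · rintro ⟨⟨z, hz, hz'⟩, ⟨w, hw, hw'⟩⟩
    refine ⟨⟨x, (hz ▸ z.2 : x.fst ∈ A.domain), (hw ▸ w.2 : x.snd ∈ B.domain)⟩, rfl, ?_⟩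
    apply (WithLp.equiv 2 _).injective
    refine Prod.ext ?_ ?_
    · refine Eq.trans ?_ hz'
      exact congrArg A (Subtype.ext hz.symm)
    · refine Eq.trans ?_ hw'
      exact congrArg B (Subtype.ext hw.symm)

namespace SesqForm

/-- The isometry `V` maps the form domain of `b` into that of `a` and preserves the form. -/
structure Embeds (V : F →ₗᵢ[ℂ] E) (b : SesqForm F) (a : SesqForm E) : Prop where
  mem : ∀ φ ∈ b.dom, V φ ∈ a.dom
  form_eq : ∀ (φ ψ : F) (hφ : φ ∈ b.dom) (hψ : ψ ∈ b.dom),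
    a.form ⟨V φ, mem φ hφ⟩ ⟨V ψ, mem ψ hψ⟩ = b.form ⟨φ, hφ⟩ ⟨ψ, hψ⟩

theorem Embeds.add {V : F →ₗᵢ[ℂ] E} {b b' : SesqForm F} {a a' : SesqForm E}
    (h : Embeds V b a) (h' : Embeds V b' a') : Embeds V (b.add b') (a.add a') where
  mem φ hφ := ⟨h.mem φ hφ.1, h'.mem φ hφ.2⟩
  form_eq φ ψ hφ hψ := congrArg₂ (· + ·) (h.form_eq φ ψ hφ.1 hψ.1) (h'.form_eq φ ψ hφ.2 hψ.2)

theorem Embeds.sub {V : F →ₗᵢ[ℂ] E} {b b' : SesqForm F} {a a' : SesqForm E}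
    (h : Embeds V b a) (h' : Embeds V b' a') : Embeds V (b.sub b') (a.sub a') where
  mem φ hφ := ⟨h.mem φ hφ.1, h'.mem φ hφ.2⟩
  form_eq φ ψ hφ hψ := congrArg₂ (· - ·) (h.form_eq φ ψ hφ.1 hψ.1) (h'.form_eq φ ψ hφ.2 hψ.2)

theorem Embeds.id (q : SesqForm E) : Embeds LinearIsometry.id q q :=
  ⟨fun _ h => h, fun _ _ _ _ => rfl⟩

theorem Embeds.restrict (q : SesqForm E) (p : Submodule ℂ E) (hp : p ≤ q.dom) :
    Embeds LinearIsometry.id (q.restrict p hp) q :=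
  ⟨fun _ h => hp h, fun _ _ _ _ => rfl⟩

theorem Embeds.ofOp {V : F →ₗᵢ[ℂ] E} {S : F →ₗ.[ℂ] F} {T : E →ₗ.[ℂ] E}
    (h : ∀ φ χ : F, (φ, χ) ∈ S.graph → (V φ, V χ) ∈ T.graph) : Embeds V (ofOp S) (ofOp T) := by
  have key : ∀ φ : S.domain, ∃ hφ : V φ ∈ T.domain, T ⟨V φ, hφ⟩ = V (S φ) := fun φ => by
    obtain ⟨y, hy, hy'⟩ : ∃ y : T.domain, (y : E) = V φ ∧ T y = V (S φ) :=
      (LinearPMap.mem_graph_iff T).1 (h _ _ (S.mem_graph φ))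
    exact ⟨hy ▸ y.2, by rw [← hy']; exact congrArg T (Subtype.ext hy.symm)⟩
  refine ⟨fun φ hφ => (key ⟨φ, hφ⟩).1, fun φ ψ hφ hψ => ?_⟩
  change ⟪T ⟨V φ, _⟩, T ⟨V ψ, _⟩⟫_ℂ = ⟪S ⟨φ, hφ⟩, S ⟨ψ, hψ⟩⟫_ℂ
  rw [(key ⟨φ, hφ⟩).2, (key ⟨ψ, hψ⟩).2, V.inner_map_map]

/-- The constants carry over because `V` preserves both forms and the norm. Since `Embeds` controls
the domain of `w` in one direction only, the converse is the separate hypothesis `hdom`. -/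
theorem IsFormPerturbation.of_embeds {V : F →ₗᵢ[ℂ] E} {b w : SesqForm F} {a w' : SesqForm E}
    (hpert : w'.IsFormPerturbation a) (h : Embeds V b a) (hw : Embeds V w w')
    (hdom : ∀ φ, V φ ∈ w'.dom → φ ∈ w.dom) : w.IsFormPerturbation b := by
  obtain ⟨hle, α, β, h0, h1, hb⟩ := hpert
  refine ⟨fun φ hφ => hdom φ (hle (h.mem φ hφ)), α, β, h0, h1, fun φ => ?_⟩
  have := hb ⟨V φ, h.mem φ φ.2⟩
  rw [h.form_eq φ φ φ.2 φ.2, V.norm_map] at this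
  refine le_trans (le_of_eq (congrArg norm ?_)) this
  exact (hw.form_eq φ φ (hdom φ (hle (h.mem φ φ.2))) (hdom φ (hle (h.mem φ φ.2)))).symm

/-- The two quadratic forms agree on the smaller domain; the order expresses the inclusion of
domains alone. -/
theorem Embeds.formLE [CompleteSpace E] [CompleteSpace F] {V : F →ₗᵢ[ℂ] E} {b : SesqForm F}
    {a : SesqForm E} (h : Embeds V b a) (ha : a.IsClosedSemibounded)
    (hb : b.IsClosedSemibounded) : FormLE V a.operator b.operator :=
  ⟨ha.isSelfAdjoint_operator, hb.isSelfAdjoint_operator, a, b, ha, hb, rfl, rfl,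
    fun φ => ⟨h.mem φ φ.2, by rw [h.form_eq φ φ φ.2 φ.2]⟩⟩

/-- The form `p` is the orthogonal sum of `q` and `r` if its space is identified with the sum of
their spaces by means of `U`. -/
structure SplitsVia (U : E ≃ₗᵢ[ℂ] WithLp 2 (F × G)) (p : SesqForm E) (q : SesqForm F)
    (r : SesqForm G) : Prop where
  mem_iff : ∀ x, x ∈ p.dom ↔ (U x).fst ∈ q.dom ∧ (U x).snd ∈ r.dom
  form_eq : ∀ (x y : E) (hx : x ∈ p.dom) (hy : y ∈ p.dom), p.form ⟨x, hx⟩ ⟨y, hy⟩ =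
    q.form ⟨(U x).fst, ((mem_iff x).1 hx).1⟩ ⟨(U y).fst, ((mem_iff y).1 hy).1⟩ +
    r.form ⟨(U x).snd, ((mem_iff x).1 hx).2⟩ ⟨(U y).snd, ((mem_iff y).1 hy).2⟩

variable {U : E ≃ₗᵢ[ℂ] WithLp 2 (F × G)}

theorem SplitsVia.add {p p' : SesqForm E} {q q' : SesqForm F} {r r' : SesqForm G}
    (h : SplitsVia U p q r) (h' : SplitsVia U p' q' r') :
    SplitsVia U (p.add p') (q.add q') (r.add r') where
  mem_iff x := ((h.mem_iff x).and (h'.mem_iff x)).trans and_and_and_comm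
  form_eq x y hx hy := (congrArg₂ (· + ·) (h.form_eq x y hx.1 hy.1)
    (h'.form_eq x y hx.2 hy.2)).trans (add_add_add_comm _ _ _ _)

theorem SplitsVia.sub {p p' : SesqForm E} {q q' : SesqForm F} {r r' : SesqForm G}
    (h : SplitsVia U p q r) (h' : SplitsVia U p' q' r') :
    SplitsVia U (p.sub p') (q.sub q') (r.sub r') where
  mem_iff x := ((h.mem_iff x).and (h'.mem_iff x)).trans and_and_and_comm
  form_eq x y hx hy := (congrArg₂ (· - ·) (h.form_eq x y hx.1 hy.1)
    (h'.form_eq x y hx.2 hy.2)).trans (add_sub_add_comm _ _ _ _)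

theorem SplitsVia.restrict {p : SesqForm E} {q : SesqForm F} {r : SesqForm G}
    (h : SplitsVia U p q r) {P : Submodule ℂ E} {Q : Submodule ℂ F} {R : Submodule ℂ G}
    (hP : P ≤ p.dom) (hQ : Q ≤ q.dom) (hR : R ≤ r.dom)
    (hiff : ∀ x, x ∈ P ↔ (U x).fst ∈ Q ∧ (U x).snd ∈ R) :
    SplitsVia U (p.restrict P hP) (q.restrict Q hQ) (r.restrict R hR) where
  mem_iff := hiff
  form_eq x y hx hy := h.form_eq x y (hP hx) (hP hy)

/-- The graph of `T` is described componentwise, and `U` preserves the inner product, which on the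
Hilbert sum is the sum of the two inner products. -/
theorem SplitsVia.ofOp {T : E →ₗ.[ℂ] E} {A : F →ₗ.[ℂ] F} {B : G →ₗ.[ℂ] G}
    (h : EqVia U T (orthSum A B)) : SplitsVia U (ofOp T) (ofOp A) (ofOp B) := by
  have key : ∀ x : T.domain, ∃ h₁ : (U x).fst ∈ A.domain, ∃ h₂ : (U x).snd ∈ B.domain,
      A ⟨_, h₁⟩ = (U (T x)).fst ∧ B ⟨_, h₂⟩ = (U (T x)).snd := fun x => by
    obtain ⟨h₁, h₂⟩ := (mem_graph_orthSum A B _ _).1 ((h x (T x)).1 (T.mem_graph x))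
    obtain ⟨y, hy, hy'⟩ : ∃ y : A.domain, (y : F) = (U x).fst ∧ A y = (U (T x)).fst :=
      (LinearPMap.mem_graph_iff A).1 h₁
    obtain ⟨z, hz, hz'⟩ : ∃ z : B.domain, (z : G) = (U x).snd ∧ B z = (U (T x)).snd :=
      (LinearPMap.mem_graph_iff B).1 h₂
    exact ⟨hy ▸ y.2, hz ▸ z.2, by rw [← hy']; exact congrArg A (Subtype.ext hy.symm),
      by rw [← hz']; exact congrArg B (Subtype.ext hz.symm)⟩
  refine ⟨fun x => ⟨fun hx => ⟨(key ⟨x, hx⟩).1, (key ⟨x, hx⟩).2.1⟩, fun ⟨h₁, h₂⟩ => ?_⟩,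
    fun x y hx hy => ?_⟩
  · have h3 := (h x (U.symm (WithLp.toLp 2 (A ⟨_, h₁⟩, B ⟨_, h₂⟩)))).2 (by
      rw [U.apply_symm_apply, mem_graph_orthSum]
      exact ⟨A.mem_graph ⟨_, h₁⟩, B.mem_graph ⟨_, h₂⟩⟩)
    exact LinearPMap.mem_domain_of_mem_graph h3
  · obtain ⟨h₁, h₂, e₁, e₂⟩ := key ⟨x, hx⟩
    obtain ⟨h₃, h₄, e₃, e₄⟩ := key ⟨y, hy⟩
    change ⟪T ⟨x, hx⟩, T ⟨y, hy⟩⟫_ℂ = ⟪A ⟨(U x).fst, h₁⟩, A ⟨(U y).fst, h₃⟩⟫_ℂ +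
      ⟪B ⟨(U x).snd, h₂⟩, B ⟨(U y).snd, h₄⟩⟫_ℂ
    rw [e₁, e₂, e₃, e₄, ← U.inner_map_map]
    rfl

/-- The inclusion of the first summand. -/
noncomputable def inlIsometry (U : E ≃ₗᵢ[ℂ] WithLp 2 (F × G)) : F →ₗᵢ[ℂ] E where
  toLinearMap := U.symm.toLinearEquiv.toLinearMap ∘ₗ
    (WithLp.linearEquiv 2 ℂ (F × G)).symm.toLinearMap ∘ₗ LinearMap.inl ℂ F G
  norm_map' x := (U.symm.norm_map _).trans (WithLp.norm_toLp_fst 2 F G x)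

/-- The inclusion of the second summand. -/
noncomputable def inrIsometry (U : E ≃ₗᵢ[ℂ] WithLp 2 (F × G)) : G →ₗᵢ[ℂ] E where
  toLinearMap := U.symm.toLinearEquiv.toLinearMap ∘ₗ
    (WithLp.linearEquiv 2 ℂ (F × G)).symm.toLinearMap ∘ₗ LinearMap.inr ℂ F G
  norm_map' x := (U.symm.norm_map _).trans (WithLp.norm_toLp_snd 2 F G x)

theorem apply_inlIsometry (x : F) : U (inlIsometry U x) = WithLp.toLp 2 (x, 0) :=
  U.apply_symm_apply _

theorem apply_inrIsometry (x : G) : U (inrIsometry U x) = WithLp.toLp 2 (0, x) :=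
  U.apply_symm_apply _

theorem fst_apply_inlIsometry (x : F) : (U (inlIsometry U x)).fst = x :=
  congrArg WithLp.fst (apply_inlIsometry x)

theorem snd_apply_inlIsometry (x : F) : (U (inlIsometry U x)).snd = 0 :=
  congrArg WithLp.snd (apply_inlIsometry x)

theorem fst_apply_inrIsometry (x : G) : (U (inrIsometry U x)).fst = 0 :=
  congrArg WithLp.fst (apply_inrIsometry x)

theorem snd_apply_inrIsometry (x : G) : (U (inrIsometry U x)).snd = x :=
  congrArg WithLp.snd (apply_inrIsometry x)

theorem SplitsVia.inl_mem_iff {p : SesqForm E} {q : SesqForm F} {r : SesqForm G}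
    (h : SplitsVia U p q r) (x : F) : inlIsometry U x ∈ p.dom ↔ x ∈ q.dom := by
  rw [h.mem_iff, apply_inlIsometry]
  exact and_iff_left r.dom.zero_mem

theorem SplitsVia.inr_mem_iff {p : SesqForm E} {q : SesqForm F} {r : SesqForm G}
    (h : SplitsVia U p q r) (x : G) : inrIsometry U x ∈ p.dom ↔ x ∈ r.dom := by
  rw [h.mem_iff, apply_inrIsometry]
  exact and_iff_right q.dom.zero_mem

/-- A vector of the first summand does not see `r`. Testing with such vectors extracts the weak
equation for `q` from the one for `p` in `SplitsVia.eqVia_operator`. -/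
theorem SplitsVia.form_inl {p : SesqForm E} {q : SesqForm F} {r : SesqForm G}
    (h : SplitsVia U p q r) (x : F) (hx : x ∈ q.dom) (y : E) (hy : y ∈ p.dom) :
    p.form ⟨inlIsometry U x, (h.inl_mem_iff x).2 hx⟩ ⟨y, hy⟩ =
      q.form ⟨x, hx⟩ ⟨(U y).fst, ((h.mem_iff y).1 hy).1⟩ := by
  rw [h.form_eq]
  have h1 : ∀ (z : F) (hz : z ∈ q.dom), z = x → (⟨z, hz⟩ : q.dom) = ⟨x, hx⟩ :=
    fun z hz e => Subtype.ext e
  have h2 : ∀ (z : G) (hz : z ∈ r.dom), z = 0 → (⟨z, hz⟩ : r.dom) = 0 :=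
    fun z hz e => Subtype.ext e
  rw [h1 _ _ (fst_apply_inlIsometry x), h2 _ _ (snd_apply_inlIsometry x), map_zero,
    LinearMap.zero_apply, add_zero]

theorem SplitsVia.form_inr {p : SesqForm E} {q : SesqForm F} {r : SesqForm G}
    (h : SplitsVia U p q r) (x : G) (hx : x ∈ r.dom) (y : E) (hy : y ∈ p.dom) :
    p.form ⟨inrIsometry U x, (h.inr_mem_iff x).2 hx⟩ ⟨y, hy⟩ =
      r.form ⟨x, hx⟩ ⟨(U y).snd, ((h.mem_iff y).1 hy).2⟩ := by
  rw [h.form_eq]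
  have h1 : ∀ (z : G) (hz : z ∈ r.dom), z = x → (⟨z, hz⟩ : r.dom) = ⟨x, hx⟩ :=
    fun z hz e => Subtype.ext e
  have h2 : ∀ (z : F) (hz : z ∈ q.dom), z = 0 → (⟨z, hz⟩ : q.dom) = 0 :=
    fun z hz e => Subtype.ext e
  rw [h1 _ _ (snd_apply_inrIsometry x), h2 _ _ (fst_apply_inrIsometry x), map_zero,
    LinearMap.zero_apply, zero_add]

theorem SplitsVia.embeds_inl {p : SesqForm E} {q : SesqForm F} {r : SesqForm G}
    (h : SplitsVia U p q r) : Embeds (inlIsometry U) q p where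
  mem x hx := (h.inl_mem_iff x).2 hx
  form_eq x y hx hy := by
    rw [h.form_inl x hx]
    congr 1
    exact Subtype.ext (fst_apply_inlIsometry y)

theorem SplitsVia.embeds_inr {p : SesqForm E} {q : SesqForm F} {r : SesqForm G}
    (h : SplitsVia U p q r) : Embeds (inrIsometry U) r p where
  mem x hx := (h.inr_mem_iff x).2 hx
  form_eq x y hx hy := by
    rw [h.form_inr x hx]
    congr 1
    exact Subtype.ext (snd_apply_inrIsometry y)

/-- The operator of an orthogonal sum of forms is the orthogonal sum of the operators. -/
theorem SplitsVia.eqVia_operator {p : SesqForm E} {q : SesqForm F} {r : SesqForm G}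
    (h : SplitsVia U p q r) (hp : Dense (p.dom : Set E)) (hq : Dense (q.dom : Set F))
    (hr : Dense (r.dom : Set G)) : EqVia U p.operator (orthSum q.operator r.operator) := by
  intro ψ χ
  rw [mem_graph_orthSum, mem_graph_operator p hp, mem_graph_operator q hq,
    mem_graph_operator r hr]
  have hinner : ∀ x : E, ⟪x, χ⟫_ℂ = ⟪(U x).fst, (U χ).fst⟫_ℂ + ⟪(U x).snd, (U χ).snd⟫_ℂ :=
    fun x => (U.inner_map_map x χ).symm
  constructor
  · rintro ⟨hψ, hψ'⟩
    obtain ⟨h₁, h₂⟩ := (h.mem_iff ψ).1 hψ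
    refine ⟨⟨h₁, fun φ => ?_⟩, ⟨h₂, fun φ => ?_⟩⟩
    · rw [← h.form_inl φ φ.2 ψ hψ, hψ', hinner, apply_inlIsometry]
      simp
    · rw [← h.form_inr φ φ.2 ψ hψ, hψ', hinner, apply_inrIsometry]
      simp
  · rintro ⟨⟨h₁, h₁'⟩, ⟨h₂, h₂'⟩⟩
    refine ⟨(h.mem_iff ψ).2 ⟨h₁, h₂⟩, fun φ => ?_⟩
    rw [hinner, ← h₁' ⟨_, ((h.mem_iff φ).1 φ.2).1⟩, ← h₂' ⟨_, ((h.mem_iff φ).1 φ.2).2⟩]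
    exact h.form_eq φ ψ φ.2 _

end SesqForm

end Comparison

/-! ### Closedness and density for the magnetic forms -/

section Magnetic

variable {d : ℕ} {Λ : Set (EuclideanSpace ℝ (Fin d))}
  {a : EuclideanSpace ℝ (Fin d) → EuclideanSpace ℝ (Fin d)}

/-- For a fixed test function the defining relation equates two continuous functions of the pair, so
the graph is an intersection of closed sets. -/
theorem isClosed_graph_magDeriv (hΛ : IsOpen Λ) (ha : AEStronglyMeasurable a volume)
    (ha2 : LocallyIntegrable (fun x => ‖a x‖ ^ 2) volume) (j : Fin d) :
    IsClosed ((magDeriv Λ a j).graph : Set (L2 Λ × L2 Λ)) := by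
  have h : ((magDeriv Λ a j).graph : Set (L2 Λ × L2 Λ)) =
      {x | ∀ η, IsTest Λ η → ∀ e g : L2 Λ, e =ᵐ[volume.restrict Λ] η →
        g =ᵐ[volume.restrict Λ] covDeriv a j η → ⟪x.1, g⟫_ℂ = ⟪x.2, e⟫_ℂ} :=
    Set.ext fun x => mem_graph_magDeriv hΛ ha ha2 j x.1 x.2
  rw [h]
  simp only [Set.ofPred_forall]
  refine isClosed_iInter fun η => isClosed_iInter fun _ => isClosed_iInter fun e =>
    isClosed_iInter fun g => isClosed_iInter fun _ => isClosed_iInter fun _ => ?_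
  exact isClosed_eq (continuous_fst.inner continuous_const)
    (continuous_snd.inner continuous_const)

/-- Convergence in `L²` gives almost everywhere convergence along a subsequence, and a pointwise
relation survives that limit. The second subsequence is taken inside the first so that both
components converge. -/
theorem isClosed_graph_mulOp (w : EuclideanSpace ℝ (Fin d) → ℝ) :
    IsClosed ((mulOp Λ w).graph : Set (L2 Λ × L2 Λ)) := by
  refine IsSeqClosed.isClosed fun u x hu hx => ?_
  have hu' : ∀ n, (u n).2 =ᵐ[volume.restrict Λ] fun y => (w y : ℂ) * (u n).1 y :=
    fun n => (mem_graph_mulOp _ _).1 (hu n)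
  refine (mem_graph_mulOp x.1 x.2).2 ?_
  have h1 : Tendsto (fun n => (u n).1) atTop (𝓝 x.1) := (continuous_fst.tendsto x).comp hx
  have h2 : Tendsto (fun n => (u n).2) atTop (𝓝 x.2) := (continuous_snd.tendsto x).comp hx
  obtain ⟨ns, hns, hlim⟩ := (tendstoInMeasure_of_tendsto_Lp h1).exists_seq_tendsto_ae
  obtain ⟨ms, hms, hlim'⟩ :=
    (tendstoInMeasure_of_tendsto_Lp (h2.comp hns.tendsto_atTop)).exists_seq_tendsto_ae
  filter_upwards [hlim, hlim', ae_all_iff.2 hu'] with y h3 h4 h5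
  refine tendsto_nhds_unique h4 ?_
  refine ((h3.comp hms.tendsto_atTop).const_mul (w y : ℂ)).congr fun n => ?_
  exact (h5 _).symm

theorem isClosedNonneg_potentialForm (w : EuclideanSpace ℝ (Fin d) → ℝ) :
    (potentialForm Λ w).IsClosedNonneg :=
  SesqForm.isClosedNonneg_ofOp (isClosed_graph_mulOp _)

/-- Up to the factor `1 / 2` this is a finite sum of forms of closed operators, each dominated by
the sum. -/
theorem isClosedNonneg_kineticN (hΛ : IsOpen Λ) (ha : AEStronglyMeasurable a volume)
    (ha2 : LocallyIntegrable (fun x => ‖a x‖ ^ 2) volume) : (kineticN Λ a).IsClosedNonneg := by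
  have hop := fun j => SesqForm.isClosedNonneg_ofOp (isClosed_graph_magDeriv hΛ ha ha2 j)
  have hquad : ∀ φ : (kineticN Λ a).dom, (kineticN Λ a).quad φ = (1 / 2 : ℝ) * ∑ j : Fin d,
      (SesqForm.ofOp (magDeriv Λ a j)).quad ⟨φ, magSobolev_le Λ a j φ.2⟩ := fun φ => by
    refine (kineticN_self Λ a φ).trans ?_
    congr 1
    exact Finset.sum_congr rfl fun j _ => norm_sq_eq_re_inner (𝕜 := ℂ) _
  refine ⟨fun φ ψ => ?_, fun φ => ?_, fun u φ hu hc => ?_⟩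
  · rw [kineticN_apply, kineticN_apply, map_mul, map_sum]
    simp_rw [inner_conj_symm]
    rw [map_div₀, map_one, Complex.conj_ofNat]
  · rw [hquad]
    exact mul_nonneg (by norm_num) (Finset.sum_nonneg fun j _ => (hop j).nonneg _)
  · have h1 := hc.const_mul 2
    rw [mul_zero] at h1
    choose hφ hlim using fun j => (hop j).closed (fun n => ⟨u n, magSobolev_le Λ a j (u n).2⟩) φ hu
      (squeeze_zero (fun _ => (hop j).nonneg _) (fun r => by
        rw [hquad, ← mul_assoc, mul_one_div_cancel two_ne_zero, one_mul]
        exact Finset.single_le_sum (f := fun j => (SesqForm.ofOp (magDeriv Λ a j)).quad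
          ⟨((u r.1 - u r.2 : (kineticN Λ a).dom) : L2 Λ), magSobolev_le Λ a j (u r.1 - u r.2).2⟩)
          (fun j _ => (hop j).nonneg _) (Finset.mem_univ j)) h1)
    refine ⟨(Submodule.mem_iInf _).2 hφ, ?_⟩
    simp_rw [hquad]
    have h2 := (tendsto_finsetSum Finset.univ fun j _ => hlim j).const_mul (1 / 2 : ℝ)
    rw [Finset.sum_const_zero, mul_zero] at h2
    exact h2

/-- For Dirichlet conditions, closedness of the Neumann form provides the limit, and it remains to
approximate that limit by test functions. -/
theorem isClosedNonneg_kinetic (X : BC) (hΛ : IsOpen Λ) (ha : AEStronglyMeasurable a volume)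
    (ha2 : LocallyIntegrable (fun x => ‖a x‖ ^ 2) volume) : (kinetic X Λ a).IsClosedNonneg := by
  have hN := isClosedNonneg_kineticN hΛ ha ha2
  cases X with
  | N => exact hN
  | D =>
    refine ⟨fun φ ψ => hN.symmetric _ _, fun φ => hN.nonneg _, fun u φ hu hc => ?_⟩
    let w : ℕ → (kineticN Λ a).dom := fun n => ⟨u n, dirichletDomain_le Λ a (u n).2⟩
    obtain ⟨hφ, hlim⟩ := hN.closed w φ hu hc
    refine ⟨⟨hφ, ?_⟩, hlim⟩
    -- Diagonal choice: a test function within `1 / (n + 1)` of the `n`-th term in the squared form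
    -- norm. These test functions then have the same limit.
    have hw : ∀ n : ℕ, ∃ t : (kineticN Λ a).dom,
        (∃ η, IsTest Λ η ∧ (t : L2 Λ) =ᵐ[volume.restrict Λ] η) ∧
        kineticNormSq Λ a (t - w n) < 1 / ((n : ℝ) + 1) := fun n => by
      obtain ⟨_, t, ht, htl⟩ := (u n).2
      obtain ⟨k, hk⟩ := (htl.eventually (gt_mem_nhds (Nat.one_div_pos_of_nat (n := n)))).exists
      exact ⟨t k, ht k, hk⟩
    choose t ht hlt using hw
    refine ⟨t, ht, ?_⟩
    have h1 : Tendsto (fun n => ‖(u n : L2 Λ) - φ‖ ^ 2) atTop (𝓝 0) := by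
      simpa using (tendsto_iff_norm_sub_tendsto_zero.1 hu).pow 2
    have h2 := (tendsto_one_div_add_atTop_nhds_zero_nat (𝕜 := ℝ)).const_mul 2 |>.add
      ((h1.add hlim).const_mul 2)
    rw [mul_zero, add_zero, mul_zero, add_zero] at h2
    refine squeeze_zero (fun n => kineticNormSq_nonneg Λ a _) (fun n => ?_) h2
    have h3 := kineticNormSq_add Λ a (t n - w n) (w n - ⟨φ, hφ⟩)
    rw [sub_add_sub_cancel] at h3
    have h4 : kineticNormSq Λ a (w n - ⟨φ, hφ⟩) =
        ‖(u n : L2 Λ) - φ‖ ^ 2 + (kineticN Λ a).quad (w n - ⟨φ, hφ⟩) := rfl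
    rw [h4] at h3
    linarith [hlt n]

theorem covDeriv_eq_zero_of_notMem_tsupport (a : EuclideanSpace ℝ (Fin d) → EuclideanSpace ℝ (Fin d))
    (j : Fin d) {η : EuclideanSpace ℝ (Fin d) → ℂ}
    {x : EuclideanSpace ℝ (Fin d)} (hx : x ∉ tsupport η) : covDeriv a j η x = 0 := by
  rw [covDeriv, image_eq_zero_of_notMem_tsupport hx, fderiv_of_notMem_tsupport (𝕜 := ℝ) hx]
  simp

/-- Integration by parts: `i ∂_j + a_j` is symmetric on test functions. -/
theorem integral_conj_mul_covDeriv (ha : AEStronglyMeasurable a volume)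
    (ha2 : LocallyIntegrable (fun x => ‖a x‖ ^ 2) volume) (j : Fin d)
    {η θ : EuclideanSpace ℝ (Fin d) → ℂ} (hη : IsTest Set.univ η) (hθ : IsTest Set.univ θ) :
    ∫ x, starRingEnd ℂ (η x) * covDeriv a j θ x = ∫ x, starRingEnd ℂ (covDeriv a j η x) * θ x := by
  set e : EuclideanSpace ℝ (Fin d) := EuclideanSpace.single j 1
  have hη2 : MemLp η 2 volume := by simpa using hη.memLp
  have hθ2 : MemLp θ 2 volume := by simpa using hθ.memLp
  have hη3 : MemLp (covDeriv a j η) 2 volume := by simpa using hη.memLp_covDeriv ha ha2 j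
  have hθ3 : MemLp (covDeriv a j θ) 2 volume := by simpa using hθ.memLp_covDeriv ha ha2 j
  have hI1 : Integrable (fun x => starRingEnd ℂ (η x) * covDeriv a j θ x) volume :=
    hη2.star.integrable_mul hθ3
  have hI2 : Integrable (fun x => starRingEnd ℂ (covDeriv a j η x) * θ x) volume :=
    hη3.star.integrable_mul hθ2
  have hdη : ∀ x, DifferentiableAt ℝ η x := fun x => (hη.1.differentiable (by simp)) x
  have hdθ : ∀ x, DifferentiableAt ℝ θ x := fun x => (hθ.1.differentiable (by simp)) x
  have hc1 : Continuous fun x => fderiv ℝ η x e :=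
    (hη.1.continuous_fderiv (by simp)).clm_apply continuous_const
  have hc2 : Continuous fun x => fderiv ℝ θ x e :=
    (hθ.1.continuous_fderiv (by simp)).clm_apply continuous_const
  have hstar : ∀ x, fderiv ℝ (fun y => starRingEnd ℂ (η y)) x e =
      starRingEnd ℂ (fderiv ℝ η x e) := fun x => by
    have := (hdη x).hasFDerivAt.star.fderiv
    exact congrArg (fun L : EuclideanSpace ℝ (Fin d) →L[ℝ] ℂ => L e) this
  have hparts := integral_mul_fderiv_eq_neg_fderiv_mul_of_integrable (μ := volume)
    (f := fun y => starRingEnd ℂ (η y)) (g := θ) (v := e)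
    (by
      simp_rw [hstar]
      exact ((Complex.continuous_conj.comp hc1).mul hθ.1.continuous).integrable_of_hasCompactSupport
        hθ.2.1.mul_left)
    (((Complex.continuous_conj.comp hη.1.continuous).mul hc2).integrable_of_hasCompactSupport
        (hθ.2.1.fderiv_apply ℝ e).mul_left)
    (((Complex.continuous_conj.comp hη.1.continuous).mul
      hθ.1.continuous).integrable_of_hasCompactSupport hθ.2.1.mul_left)
    (fun x _ => (hdη x).star) (fun x _ => hdθ x)
  simp_rw [hstar] at hparts
  have hJ1 : Integrable (fun x => starRingEnd ℂ (η x) * fderiv ℝ θ x e) volume :=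
    ((Complex.continuous_conj.comp hη.1.continuous).mul hc2).integrable_of_hasCompactSupport
      (hθ.2.1.fderiv_apply ℝ e).mul_left
  have hJ2 : Integrable (fun x => starRingEnd ℂ (fderiv ℝ η x e) * θ x) volume :=
    ((Complex.continuous_conj.comp hc1).mul hθ.1.continuous).integrable_of_hasCompactSupport
        hθ.2.1.mul_left
  rw [← sub_eq_zero, ← integral_sub hI1 hI2]
  -- As `a` is real its terms cancel, and `conj i = -i` turns the rest into `i` times the derivative
  -- of `conj η * θ`, whose integral vanishes.
  have : ∀ x, starRingEnd ℂ (η x) * covDeriv a j θ x - starRingEnd ℂ (covDeriv a j η x) * θ x =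
      Complex.I * (starRingEnd ℂ (η x) * fderiv ℝ θ x e +
        starRingEnd ℂ (fderiv ℝ η x e) * θ x) := fun x => by
    simp only [covDeriv, map_add, map_mul, Complex.conj_I, Complex.conj_ofReal]
    ring
  simp_rw [this]
  rw [integral_const_mul, integral_add hJ1 hJ2, hparts, neg_add_cancel, mul_zero]

theorem IsTest.mono {Λ' : Set (EuclideanSpace ℝ (Fin d))} (h : Λ ⊆ Λ')
    {η : EuclideanSpace ℝ (Fin d) → ℂ} (hη : IsTest Λ η) : IsTest Λ' η :=
  ⟨hη.1, hη.2.1, hη.2.2.trans h⟩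

/-- On test functions the distributional operator is `η ↦ i ∂_j η + a_j η`. -/
theorem mem_graph_magDeriv_of_isTest (hΛ : IsOpen Λ) (ha : AEStronglyMeasurable a volume)
    (ha2 : LocallyIntegrable (fun x => ‖a x‖ ^ 2) volume) (j : Fin d)
    {η : EuclideanSpace ℝ (Fin d) → ℂ} (hη : IsTest Λ η) {e g : L2 Λ}
    (he : e =ᵐ[volume.restrict Λ] η) (hg : g =ᵐ[volume.restrict Λ] covDeriv a j η) :
    (e, g) ∈ (magDeriv Λ a j).graph := by
  rw [mem_graph_magDeriv hΛ ha ha2, mem_magGraph_iff ha ha2]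
  intro θ hθ
  have h1 : ∫ x in Λ, starRingEnd ℂ (e x) * covDeriv a j θ x =
      ∫ x, starRingEnd ℂ (η x) * covDeriv a j θ x := by
    refine Eq.trans (integral_congr_ae ?_)
      (setIntegral_eq_integral_of_forall_compl_eq_zero (s := Λ) fun x hx => by
        rw [image_eq_zero_of_notMem_tsupport fun h => hx (hη.2.2 h), map_zero, zero_mul])
    filter_upwards [he] with x hx
    rw [hx]
  have h2 : ∫ x in Λ, starRingEnd ℂ (g x) * θ x =
      ∫ x, starRingEnd ℂ (covDeriv a j η x) * θ x := by
    refine Eq.trans (integral_congr_ae ?_)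
      (setIntegral_eq_integral_of_forall_compl_eq_zero (s := Λ) fun x hx => by
        rw [image_eq_zero_of_notMem_tsupport fun h => hx (hθ.2.2 h), mul_zero])
    filter_upwards [hg] with x hx
    rw [hx]
  exact h1.trans ((integral_conj_mul_covDeriv ha ha2 j (hη.mono (Set.subset_univ _))
    (hθ.mono (Set.subset_univ _))).trans h2.symm)

theorem mem_kineticN_dom_of_isTest (hΛ : IsOpen Λ) (ha : AEStronglyMeasurable a volume)
    (ha2 : LocallyIntegrable (fun x => ‖a x‖ ^ 2) volume)
    {η : EuclideanSpace ℝ (Fin d) → ℂ} (hη : IsTest Λ η) {e : L2 Λ}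
    (he : e =ᵐ[volume.restrict Λ] η) : e ∈ (kineticN Λ a).dom :=
  (Submodule.mem_iInf _).2 fun j => LinearPMap.mem_domain_of_mem_graph
    (mem_graph_magDeriv_of_isTest hΛ ha ha2 j hη he (hη.memLp_covDeriv ha ha2 j).coeFn_toLp)

theorem mem_kinetic_dom_of_isTest (X : BC) (hΛ : IsOpen Λ) (ha : AEStronglyMeasurable a volume)
    (ha2 : LocallyIntegrable (fun x => ‖a x‖ ^ 2) volume)
    {η : EuclideanSpace ℝ (Fin d) → ℂ} (hη : IsTest Λ η) {e : L2 Λ}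
    (he : e =ᵐ[volume.restrict Λ] η) : e ∈ (kinetic X Λ a).dom := by
  have hN := mem_kineticN_dom_of_isTest hΛ ha ha2 hη he
  cases X with
  | N => exact hN
  | D =>
    refine ⟨hN, fun _ => ⟨e, hN⟩, fun _ => ⟨η, hη, he⟩, ?_⟩
    simp [kineticNormSq]

theorem vPos_nonneg (v : EuclideanSpace ℝ (Fin d) → ℝ) (x : EuclideanSpace ℝ (Fin d)) :
    0 ≤ vPos v x := by
  rw [vPos]
  linarith [neg_abs_le (v x)]

/-- The square `w |η|²` is a locally integrable function times a continuous one of compact support.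
-/
theorem mem_potentialForm_dom_of_isTest {w : EuclideanSpace ℝ (Fin d) → ℝ}
    (hw : AEStronglyMeasurable w volume) (hw0 : ∀ x, 0 ≤ w x)
    (hloc : LocallyIntegrable w volume)
    {η : EuclideanSpace ℝ (Fin d) → ℂ} (hη : IsTest Λ η) {e : L2 Λ}
    (he : e =ᵐ[volume.restrict Λ] η) : e ∈ (potentialForm Λ w).dom := by
  have hm : MemLp (fun x => (Real.sqrt (w x) : ℂ) * η x) 2 (volume.restrict Λ) := by
    refine MemLp.restrict Λ ?_
    rw [memLp_two_iff_integrable_sq_norm]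
    · have hc : Continuous fun x => ‖η x‖ ^ 2 := hη.1.continuous.norm.pow 2
      have hs : HasCompactSupport fun x => ‖η x‖ ^ 2 :=
        hη.2.1.comp_left (g := fun z : ℂ => ‖z‖ ^ 2) (by simp)
      refine (hloc.integrable_smul_right_of_hasCompactSupport hc hs).congr
        (Eventually.of_forall fun x => ?_)
      simp only [norm_mul, Complex.norm_real, mul_pow, Real.norm_eq_abs, sq_abs,
        Real.sq_sqrt (hw0 x), smul_eq_mul]
    · exact (Complex.continuous_ofReal.comp_aestronglyMeasurable
        (Real.continuous_sqrt.comp_aestronglyMeasurable hw)).mul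
        hη.1.continuous.aestronglyMeasurable
  refine LinearPMap.mem_domain_of_mem_graph (y := hm.toLp) ((mem_graph_mulOp e _).2 ?_)
  filter_upwards [hm.coeFn_toLp, he] with x h1 h2
  rw [h1, h2]

/-- A subspace of `L²(Λ)` that contains the test functions is dense. -/
theorem dense_of_isTest_mem (hΛ : IsOpen Λ) (P : Submodule ℂ (L2 Λ))
    (hP : ∀ (η : EuclideanSpace ℝ (Fin d) → ℂ) (e : L2 Λ), IsTest Λ η →
      e =ᵐ[volume.restrict Λ] η → e ∈ P) : Dense (P : Set (L2 Λ)) := by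
  rw [Submodule.dense_iff_topologicalClosure_eq_top, Submodule.topologicalClosure_eq_top_iff,
    Submodule.eq_bot_iff]
  intro y hy
  have hyc : LocallyIntegrable y (volume.restrict Λ) := (Lp.memLp y).locallyIntegrable (by norm_num)
  -- Orthogonality to real-valued test functions already suffices for the fundamental lemma of the
  -- calculus of variations.
  have key := hΛ.ae_eq_zero_of_integral_contDiff_smul_eq_zero (hyc.locallyIntegrableOn Λ)
    (fun g hg hgc hgs => by
      have hT : IsTest Λ (fun x => (g x : ℂ)) :=
        ⟨Complex.ofRealCLM.contDiff.comp hg, hgc.comp_left (g := fun r : ℝ => (r : ℂ)) (by simp),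
          (closure_mono (Function.support_comp_subset (g := fun r : ℝ => (r : ℂ)) (by simp) g)).trans
            hgs⟩
      have h1 := (Submodule.mem_orthogonal _ _).1 hy _ (hP _ _ hT hT.memLp.coeFn_toLp)
      rw [L2.inner_def] at h1
      rw [← h1]
      refine integral_congr_ae ?_
      filter_upwards [hT.memLp.coeFn_toLp] with x hx
      rw [hx, RCLike.inner_apply, Complex.conj_ofReal, Complex.real_smul, mul_comm])
  refine Lp.ext ?_
  filter_upwards [(ae_restrict_iff' hΛ.measurableSet).2
    ((ae_restrict_iff' hΛ.measurableSet).1 key |>.mono fun x hx => hx),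
    ae_restrict_mem hΛ.measurableSet, Lp.coeFn_zero ℂ 2 (volume.restrict Λ)] with x hx hxΛ hx0
  rw [hx0, Pi.zero_apply]
  exact hx hxΛ

/-- If `v₋` is a form perturbation, then `H_{Λ,X}(a, v)` is well defined. -/
theorem magOpDefined_of_isFormPerturbation {X : BC} {v : EuclideanSpace ℝ (Fin d) → ℝ}
    (hΛ : IsOpen Λ) (ha : AEStronglyMeasurable a volume) (hv : AEStronglyMeasurable v volume)
    (ha2 : LocallyIntegrable (fun x => ‖a x‖ ^ 2) volume)
    (hv2 : LocallyIntegrable (vPos v) volume)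
    (hpert : (potentialForm Λ (vNeg v)).IsFormPerturbation (kinetic X Λ a)) :
    MagOpDefined X Λ a v := by
  -- The form domain contains the test functions. No local integrability of `v₋` is needed: its form
  -- domain contains the kinetic one by the form bound.
  have hdense : Dense ((magForm X Λ a v).dom : Set (L2 Λ)) := by
    refine dense_of_isTest_mem hΛ _ fun η e hη he => ?_
    rw [magForm_dom hpert]
    refine ⟨mem_kinetic_dom_of_isTest X hΛ ha ha2 hη he, mem_potentialForm_dom_of_isTest ?_
      (vPos_nonneg v) hv2 hη he⟩
    have h1 : AEStronglyMeasurable (fun x => |v x|) volume := hv.norm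
    refine ((h1.add hv).mul_const (2⁻¹ : ℝ)).congr (Eventually.of_forall fun x => ?_)
    rw [vPos, div_eq_mul_inv]
    rfl
  have hc : (magForm X Λ a v).IsClosedSemibounded :=
    (isClosedNonneg_kinetic X hΛ ha ha2).isClosedSemibounded_sub (isClosedNonneg_potentialForm _)
      (isClosedNonneg_potentialForm _).symmetric hpert hdense
  exact ⟨hpert, hc, hc.isSelfAdjoint_operator⟩

end Magnetic

/-! ### Decoupling over disjoint open sets -/

section Decomposition

variable {d : ℕ} {S T Λ₁ Λ₂ : Set (EuclideanSpace ℝ (Fin d))}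
  {a : EuclideanSpace ℝ (Fin d) → EuclideanSpace ℝ (Fin d)}

/-- Distributional derivatives restrict to open subsets. -/
theorem mem_graph_magDeriv_restrictL2 (hS : IsOpen S) (hT : IsOpen T) (h : T ⊆ S)
    (ha : AEStronglyMeasurable a volume) (ha2 : LocallyIntegrable (fun x => ‖a x‖ ^ 2) volume)
    (j : Fin d) {φ χ : L2 S} (hφ : (φ, χ) ∈ (magDeriv S a j).graph) :
    (restrictL2 h φ, restrictL2 h χ) ∈ (magDeriv T a j).graph := by
  rw [mem_graph_magDeriv hT ha ha2, mem_magGraph_iff ha ha2]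
  rw [mem_graph_magDeriv hS ha ha2, mem_magGraph_iff ha ha2] at hφ
  intro η hη
  -- A test function on `T` is one on `S`, and the integrals over `S` and `T` agree because the
  -- integrands vanish off its support.
  have h0 := hφ η (hη.mono h)
  have h1 : ∫ x in T, starRingEnd ℂ (restrictL2 h φ x) * covDeriv a j η x =
      ∫ x in S, starRingEnd ℂ (φ x) * covDeriv a j η x := by
    refine Eq.trans (integral_congr_ae ?_)
      (setIntegral_eq_of_subset_of_forall_sdiff_eq_zero hS.measurableSet h fun x hx => by
        rw [covDeriv_eq_zero_of_notMem_tsupport a j fun h => hx.2 (hη.2.2 h), mul_zero]).symm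
    filter_upwards [coeFn_restrictL2 h φ] with x hx
    rw [hx]
  have h2 : ∫ x in T, starRingEnd ℂ (restrictL2 h χ x) * η x =
      ∫ x in S, starRingEnd ℂ (χ x) * η x := by
    refine Eq.trans (integral_congr_ae ?_)
      (setIntegral_eq_of_subset_of_forall_sdiff_eq_zero hS.measurableSet h fun x hx => by
        rw [image_eq_zero_of_notMem_tsupport fun h => hx.2 (hη.2.2 h), mul_zero]).symm
    filter_upwards [coeFn_restrictL2 h χ] with x hx
    rw [hx]
  exact h1.trans (h0.trans h2.symm)

/-- A test function on a disjoint union is cut into test functions on the parts. -/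
theorem IsTest.indicator (h₁ : IsOpen Λ₁) (h₂ : IsOpen Λ₂) (hdisj : Disjoint Λ₁ Λ₂)
    {η : EuclideanSpace ℝ (Fin d) → ℂ} (hη : IsTest (Λ₁ ∪ Λ₂) η) :
    IsTest Λ₁ (Λ₁.indicator η) := by
  classical
  have hsupp : Function.support (Λ₁.indicator η) ⊆ Function.support η := by
    rw [Set.support_indicator]
    exact Set.inter_subset_right
  refine ⟨contDiff_iff_contDiffAt.2 fun x => ?_, hη.2.1.mono hsupp, fun x hx => ?_⟩
  · by_cases hx : x ∈ Λ₁
    · refine hη.1.contDiffAt.congr_of_eventuallyEq ?_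
      filter_upwards [h₁.mem_nhds hx] with y hy
      exact Set.indicator_of_mem hy η
    · refine (contDiffAt_const (c := (0 : ℂ))).congr_of_eventuallyEq ?_
      -- Outside `Λ₁` the cut-off vanishes near each point: either the point lies in the open set
      -- `Λ₂`, disjoint from `Λ₁`, or it lies off the support of `η`.
      by_cases hx2 : x ∈ Λ₂
      · filter_upwards [h₂.mem_nhds hx2] with y hy
        exact Set.indicator_of_notMem (Set.disjoint_right.1 hdisj hy) η
      · have hx3 : x ∉ tsupport η := fun h => (hη.2.2 h).elim hx hx2
        filter_upwards [notMem_tsupport_iff_eventuallyEq.1 hx3] with y hy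
        rw [Set.indicator_apply, hy, Pi.zero_apply, ite_self]
  · refine (hη.2.2 (closure_mono hsupp hx)).resolve_right fun hx2 => ?_
    have : tsupport (Λ₁.indicator η) ⊆ Λ₂ᶜ :=
      closure_minimal (Set.support_indicator_subset.trans hdisj.subset_compl_right)
        h₂.isClosed_compl
    exact this hx hx2

theorem covDeriv_indicator (a : EuclideanSpace ℝ (Fin d) → EuclideanSpace ℝ (Fin d)) (j : Fin d)
    (h₁ : IsOpen Λ₁) (η : EuclideanSpace ℝ (Fin d) → ℂ)
    {x : EuclideanSpace ℝ (Fin d)} (hx : x ∈ Λ₁) :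
    covDeriv a j (Λ₁.indicator η) x = covDeriv a j η x := by
  have h : Λ₁.indicator η =ᶠ[𝓝 x] η := by
    filter_upwards [h₁.mem_nhds hx] with y hy
    exact Set.indicator_of_mem hy η
  rw [covDeriv, covDeriv, h.fderiv_eq, h.eq_of_nhds]

/-- The distributional derivative on a disjoint union is the sum of those on the parts. -/
theorem eqVia_magDeriv (h₁ : IsOpen Λ₁) (h₂ : IsOpen Λ₂) (hdisj : Disjoint Λ₁ Λ₂)
    (ha : AEStronglyMeasurable a volume) (ha2 : LocallyIntegrable (fun x => ‖a x‖ ^ 2) volume)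
    (j : Fin d) : EqVia (splitL2 h₁.measurableSet h₂.measurableSet hdisj)
      (magDeriv (Λ₁ ∪ Λ₂) a j) (orthSum (magDeriv Λ₁ a j) (magDeriv Λ₂ a j)) := by
  intro φ χ
  rw [mem_graph_orthSum]
  refine ⟨fun h => ⟨mem_graph_magDeriv_restrictL2 (h₁.union h₂) h₁ Set.subset_union_left ha ha2 j h,
    mem_graph_magDeriv_restrictL2 (h₁.union h₂) h₂ Set.subset_union_right ha ha2 j h⟩, ?_⟩
  rintro ⟨hl, hr⟩
  replace hl : (restrictL2 Set.subset_union_left φ, restrictL2 Set.subset_union_left χ) ∈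
    (magDeriv Λ₁ a j).graph := hl
  replace hr : (restrictL2 Set.subset_union_right φ, restrictL2 Set.subset_union_right χ) ∈
    (magDeriv Λ₂ a j).graph := hr
  rw [mem_graph_magDeriv h₁ ha ha2, mem_magGraph_iff ha ha2] at hl
  rw [mem_graph_magDeriv h₂ ha ha2, mem_magGraph_iff ha ha2] at hr
  rw [mem_graph_magDeriv (h₁.union h₂) ha ha2, mem_magGraph_iff ha ha2]
  intro η hη
  have hI1 : IntegrableOn (fun x => starRingEnd ℂ (φ x) * covDeriv a j η x) (Λ₁ ∪ Λ₂) volume :=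
    (Lp.memLp φ).star.integrable_mul (hη.memLp_covDeriv ha ha2 j)
  have hI2 : IntegrableOn (fun x => starRingEnd ℂ (χ x) * η x) (Λ₁ ∪ Λ₂) volume :=
    (Lp.memLp χ).star.integrable_mul hη.memLp
  -- On each open piece the cut-off and `η` have the same values and derivatives, so the relation
  -- for the cut-off is the relation for `η` integrated over that piece.
  have part : ∀ (Λ : Set (EuclideanSpace ℝ (Fin d))) (hΛ : IsOpen Λ) (h : Λ ⊆ Λ₁ ∪ Λ₂),
      ∫ x in Λ, starRingEnd ℂ (restrictL2 h φ x) * covDeriv a j (Λ.indicator η) x =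
        ∫ x in Λ, starRingEnd ℂ (restrictL2 h χ x) * Λ.indicator η x →
      ∫ x in Λ, starRingEnd ℂ (φ x) * covDeriv a j η x =
        ∫ x in Λ, starRingEnd ℂ (χ x) * η x := by
    intro Λ hΛ h heq
    refine Eq.trans (integral_congr_ae ?_) (heq.trans (integral_congr_ae ?_))
    · filter_upwards [coeFn_restrictL2 h φ, ae_restrict_mem hΛ.measurableSet] with x hx hxΛ
      rw [hx, covDeriv_indicator a j hΛ η hxΛ]
    · filter_upwards [coeFn_restrictL2 h χ, ae_restrict_mem hΛ.measurableSet] with x hx hxΛ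
      rw [hx, Set.indicator_of_mem hxΛ]
  have e1 := part Λ₁ h₁ Set.subset_union_left (hl _ (hη.indicator h₁ h₂ hdisj))
  have e2 := part Λ₂ h₂ Set.subset_union_right
    (hr _ (IsTest.indicator h₂ h₁ hdisj.symm (Set.union_comm Λ₁ Λ₂ ▸ hη)))
  refine (setIntegral_union hdisj h₂.measurableSet (hI1.mono_set Set.subset_union_left)
    (hI1.mono_set Set.subset_union_right)).trans ?_
  rw [e1, e2]
  exact (setIntegral_union hdisj h₂.measurableSet (hI2.mono_set Set.subset_union_left)
    (hI2.mono_set Set.subset_union_right)).symm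

theorem splitsVia_kineticN (h₁ : IsOpen Λ₁) (h₂ : IsOpen Λ₂) (hdisj : Disjoint Λ₁ Λ₂)
    (ha : AEStronglyMeasurable a volume) (ha2 : LocallyIntegrable (fun x => ‖a x‖ ^ 2) volume) :
    SesqForm.SplitsVia (splitL2 h₁.measurableSet h₂.measurableSet hdisj)
      (kineticN (Λ₁ ∪ Λ₂) a) (kineticN Λ₁ a) (kineticN Λ₂ a) := by
  have hs := fun j => SesqForm.SplitsVia.ofOp (eqVia_magDeriv h₁ h₂ hdisj ha ha2 j)
  refine ⟨fun x => ?_, fun x y hx hy => ?_⟩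
  · change x ∈ magSobolev _ _ ↔ _ ∈ magSobolev _ _ ∧ _ ∈ magSobolev _ _
    simp only [magSobolev, Submodule.mem_iInf]
    rw [← forall_and]
    exact forall_congr' fun j => (hs j).mem_iff x
  · rw [kineticN_apply, kineticN_apply, kineticN_apply, ← mul_add, ← Finset.sum_add_distrib]
    congr 1
    exact Finset.sum_congr rfl fun j _ => (hs j).form_eq x y (magSobolev_le _ a j hx)
      (magSobolev_le _ a j hy)

/-- The squared form norm is additive under the splitting. Approximating test functions on the union
are cut by indicators into approximations on the parts; conversely, approximations on the parts are
added. -/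
theorem mem_dirichletDomain_union_iff (h₁ : IsOpen Λ₁) (h₂ : IsOpen Λ₂) (hdisj : Disjoint Λ₁ Λ₂)
    (ha : AEStronglyMeasurable a volume) (ha2 : LocallyIntegrable (fun x => ‖a x‖ ^ 2) volume)
    (x : L2 (Λ₁ ∪ Λ₂)) : x ∈ dirichletDomain (Λ₁ ∪ Λ₂) a ↔
      (splitL2 h₁.measurableSet h₂.measurableSet hdisj x).fst ∈ dirichletDomain Λ₁ a ∧
      (splitL2 h₁.measurableSet h₂.measurableSet hdisj x).snd ∈ dirichletDomain Λ₂ a := by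
  set U := splitL2 h₁.measurableSet h₂.measurableSet hdisj
  have hs : SesqForm.SplitsVia U _ _ _ := splitsVia_kineticN h₁ h₂ hdisj ha ha2
  have hnorm : ∀ (y : L2 (Λ₁ ∪ Λ₂)) (hy : y ∈ (kineticN (Λ₁ ∪ Λ₂) a).dom)
      (y₁ : (kineticN Λ₁ a).dom) (y₂ : (kineticN Λ₂ a).dom), (U y).fst = y₁ → (U y).snd = y₂ →
      kineticNormSq (Λ₁ ∪ Λ₂) a ⟨y, hy⟩ = kineticNormSq Λ₁ a y₁ + kineticNormSq Λ₂ a y₂ := by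
    rintro y hy ⟨y₁, hy₁⟩ ⟨y₂, hy₂⟩ rfl rfl
    simp only [kineticNormSq]
    rw [hs.form_eq y y hy hy, Complex.add_re, ← U.norm_map y, WithLp.prod_norm_sq_eq_of_L2]
    ring
  constructor
  · rintro ⟨hx, u, hu, hlim⟩
    have hu1 : ∀ n, (U (u n)).fst ∈ (kineticN Λ₁ a).dom := fun n => ((hs.mem_iff _).1 (u n).2).1
    have hu2 : ∀ n, (U (u n)).snd ∈ (kineticN Λ₂ a).dom := fun n => ((hs.mem_iff _).1 (u n).2).2
    obtain ⟨hx1, hx2⟩ := (hs.mem_iff x).1 hx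
    have hsum : ∀ n, kineticNormSq (Λ₁ ∪ Λ₂) a (u n - ⟨x, hx⟩) =
        kineticNormSq Λ₁ a (⟨(U (u n)).fst, hu1 n⟩ - ⟨(U x).fst, hx1⟩) +
        kineticNormSq Λ₂ a (⟨(U (u n)).snd, hu2 n⟩ - ⟨(U x).snd, hx2⟩) := fun n =>
      hnorm _ _ _ _ (congrArg WithLp.fst (U.map_sub (u n) x))
        (congrArg WithLp.snd (U.map_sub (u n) x))
    simp_rw [hsum] at hlim
    refine ⟨⟨hx1, fun n => ⟨(U (u n)).fst, hu1 n⟩, fun n => ?_,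
        squeeze_zero (fun _ => kineticNormSq_nonneg _ _ _)
        (fun _ => le_add_of_nonneg_right (kineticNormSq_nonneg _ _ _)) hlim⟩,
      ⟨hx2, fun n => ⟨(U (u n)).snd, hu2 n⟩, fun n => ?_,
        squeeze_zero (fun _ => kineticNormSq_nonneg _ _ _)
        (fun _ => le_add_of_nonneg_left (kineticNormSq_nonneg _ _ _)) hlim⟩⟩
    · obtain ⟨η, hη, hη'⟩ := hu n
      refine ⟨_, hη.indicator h₁ h₂ hdisj, ?_⟩
      filter_upwards [coeFn_restrictL2 Set.subset_union_left (u n : L2 (Λ₁ ∪ Λ₂)),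
        ae_mono (Measure.restrict_mono_set volume Set.subset_union_left) hη',
        ae_restrict_mem h₁.measurableSet] with y hy1 hy2 hy3
      rw [Set.indicator_of_mem hy3, ← hy2]
      exact hy1
    · obtain ⟨η, hη, hη'⟩ := hu n
      refine ⟨_, IsTest.indicator h₂ h₁ hdisj.symm (Set.union_comm Λ₁ Λ₂ ▸ hη), ?_⟩
      filter_upwards [coeFn_restrictL2 Set.subset_union_right (u n : L2 (Λ₁ ∪ Λ₂)),
        ae_mono (Measure.restrict_mono_set volume Set.subset_union_right) hη',
        ae_restrict_mem h₂.measurableSet] with y hy1 hy2 hy3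
      rw [Set.indicator_of_mem hy3, ← hy2]
      exact hy1
  · rintro ⟨⟨hx1, u, hu, hulim⟩, ⟨hx2, w, hw, hwlim⟩⟩
    have hx := (hs.mem_iff x).2 ⟨hx1, hx2⟩
    -- The element with components `u n` and `w n`; it is represented by `η + θ`, as each of these
    -- test functions vanishes on the other set.
    let t : ℕ → L2 (Λ₁ ∪ Λ₂) := fun n => U.symm (WithLp.toLp 2 ((u n : L2 Λ₁), (w n : L2 Λ₂)))
    have hUt : ∀ n, U (t n) = WithLp.toLp 2 ((u n : L2 Λ₁), (w n : L2 Λ₂)) :=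
      fun n => U.apply_symm_apply _
    have ht1 : ∀ n, (U (t n)).fst = u n := fun n => congrArg WithLp.fst (hUt n)
    have ht2 : ∀ n, (U (t n)).snd = w n := fun n => congrArg WithLp.snd (hUt n)
    have ht : ∀ n, t n ∈ (kineticN (Λ₁ ∪ Λ₂) a).dom := fun n =>
      (hs.mem_iff _).2 ⟨ht1 n ▸ (u n).2, ht2 n ▸ (w n).2⟩
    refine ⟨hx, fun n => ⟨t n, ht n⟩, fun n => ?_, ?_⟩
    · obtain ⟨η, hη, hη'⟩ := hu n
      obtain ⟨θ, hθ, hθ'⟩ := hw n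
      refine ⟨η + θ, (hη.mono Set.subset_union_left).add (hθ.mono Set.subset_union_right), ?_⟩
      change ∀ᵐ y ∂(volume.restrict (Λ₁ ∪ Λ₂)), t n y = (η + θ) y
      rw [ae_restrict_union_iff]
      constructor
      · have h3 := coeFn_restrictL2 (Set.subset_union_left (s := Λ₁) (t := Λ₂)) (t n)
        have h4 : restrictL2 Set.subset_union_left (t n) = (u n : L2 Λ₁) := ht1 n
        rw [h4] at h3
        filter_upwards [h3, hη', ae_restrict_mem h₁.measurableSet] with y hy1 hy2 hy3
        rw [← hy1, hy2, Pi.add_apply, image_eq_zero_of_notMem_tsupport (f := θ)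
          (fun h => Set.disjoint_left.1 hdisj hy3 (hθ.2.2 h)), add_zero]
      · have h3 := coeFn_restrictL2 (Set.subset_union_right (s := Λ₁) (t := Λ₂)) (t n)
        have h4 : restrictL2 Set.subset_union_right (t n) = (w n : L2 Λ₂) := ht2 n
        rw [h4] at h3
        filter_upwards [h3, hθ', ae_restrict_mem h₂.measurableSet] with y hy1 hy2 hy3
        rw [← hy1, hy2, Pi.add_apply, image_eq_zero_of_notMem_tsupport (f := η)
          (fun h => Set.disjoint_right.1 hdisj hy3 (hη.2.2 h)), zero_add]
    · have h3 := hulim.add hwlim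
      rw [add_zero] at h3
      refine h3.congr fun n => (hnorm _ _ _ _ ?_ ?_).symm
      · exact (congrArg WithLp.fst (U.map_sub (t n) x)).trans
          (congrArg (· - (U x).fst) (ht1 n))
      · exact (congrArg WithLp.snd (U.map_sub (t n) x)).trans
          (congrArg (· - (U x).snd) (ht2 n))

theorem splitsVia_kinetic (X : BC) (h₁ : IsOpen Λ₁) (h₂ : IsOpen Λ₂) (hdisj : Disjoint Λ₁ Λ₂)
    (ha : AEStronglyMeasurable a volume) (ha2 : LocallyIntegrable (fun x => ‖a x‖ ^ 2) volume) :
    SesqForm.SplitsVia (splitL2 h₁.measurableSet h₂.measurableSet hdisj)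
      (kinetic X (Λ₁ ∪ Λ₂) a) (kinetic X Λ₁ a) (kinetic X Λ₂ a) :=
  match X with
  | BC.N => splitsVia_kineticN h₁ h₂ hdisj ha ha2
  | BC.D => (splitsVia_kineticN h₁ h₂ hdisj ha ha2).restrict _ _ _
      (mem_dirichletDomain_union_iff h₁ h₂ hdisj ha ha2)

theorem splitsVia_potentialForm (w : EuclideanSpace ℝ (Fin d) → ℝ) (hS : MeasurableSet S)
    (hT : MeasurableSet T) (hST : Disjoint S T) :
    SesqForm.SplitsVia (splitL2 hS hT hST) (potentialForm (S ∪ T) w) (potentialForm S w)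
      (potentialForm T w) := by
  refine SesqForm.SplitsVia.ofOp fun φ χ => ?_
  rw [mem_graph_orthSum, mem_graph_mulOp, mem_graph_mulOp, mem_graph_mulOp]
  have part : ∀ (Λ : Set (EuclideanSpace ℝ (Fin d))) (h : Λ ⊆ S ∪ T),
      (restrictL2 h χ =ᵐ[volume.restrict Λ] fun y => (Real.sqrt (w y) : ℂ) * restrictL2 h φ y) ↔
      ∀ᵐ y ∂(volume.restrict Λ), χ y = (Real.sqrt (w y) : ℂ) * φ y := by
    intro Λ h
    refine eventually_congr ?_
    filter_upwards [coeFn_restrictL2 h φ, coeFn_restrictL2 h χ] with y h1 h2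
    rw [h1, h2]
  refine (ae_restrict_union_iff S T _).trans (and_congr ?_ ?_)
  · exact (part S Set.subset_union_left).symm
  · exact (part T Set.subset_union_right).symm

end Decomposition

/-! ### Removing a null set from the domain -/

section NullSets

variable {d : ℕ} {S T : Set (EuclideanSpace ℝ (Fin d))}
  {a : EuclideanSpace ℝ (Fin d) → EuclideanSpace ℝ (Fin d)}

theorem ae_restrict_iff_of_null_sdiff (h : T ⊆ S) (h0 : volume (S \ T) = 0)
    (p : EuclideanSpace ℝ (Fin d) → Prop) :
    (∀ᵐ x ∂(volume.restrict S), p x) ↔ ∀ᵐ x ∂(volume.restrict T), p x := by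
  rw [Measure.restrict_congr_set
    ((ae_le_set.2 h0).antisymm (Eventually.of_forall (fun _ hx => h hx)))]

theorem coeFn_nullRestrictL2 (h : T ⊆ S) (h0 : volume (S \ T) = 0) (f : L2 S) :
    nullRestrictL2 h h0 f =ᵐ[volume.restrict T] f :=
  coeFn_restrictL2 h f

theorem mem_graph_mulOp_nullRestrictL2 (h : T ⊆ S) (h0 : volume (S \ T) = 0)
    (w : EuclideanSpace ℝ (Fin d) → ℝ) (φ χ : L2 S) :
    (nullRestrictL2 h h0 φ, nullRestrictL2 h h0 χ) ∈ (mulOp T w).graph ↔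
      (φ, χ) ∈ (mulOp S w).graph := by
  rw [mem_graph_mulOp, mem_graph_mulOp]
  refine Iff.trans (eventually_congr ?_) (ae_restrict_iff_of_null_sdiff h h0 _).symm
  filter_upwards [coeFn_nullRestrictL2 h h0 φ, coeFn_nullRestrictL2 h h0 χ] with y h1 h2
  rw [h1, h2]

/-- Multiplication does not see null sets, so the potential forms embed in both directions. For the
kinetic forms only one direction is available for each boundary condition. -/
theorem embeds_potentialForm_nullRestrictL2 (h : T ⊆ S) (h0 : volume (S \ T) = 0)
    (w : EuclideanSpace ℝ (Fin d) → ℝ) :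
    SesqForm.Embeds (nullRestrictL2 h h0).toLinearIsometry (potentialForm S w)
      (potentialForm T w) :=
  SesqForm.Embeds.ofOp fun φ χ => (mem_graph_mulOp_nullRestrictL2 h h0 _ φ χ).2

theorem embeds_potentialForm_nullRestrictL2_symm (h : T ⊆ S) (h0 : volume (S \ T) = 0)
    (w : EuclideanSpace ℝ (Fin d) → ℝ) :
    SesqForm.Embeds (nullRestrictL2 h h0).symm.toLinearIsometry (potentialForm T w)
      (potentialForm S w) :=
  SesqForm.Embeds.ofOp fun φ χ hφ => (mem_graph_mulOp_nullRestrictL2 h h0 _ _ _).1 (by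
    simpa using hφ)

/-- Fewer test functions on `T` make the condition for a weak derivative weaker, and the derivative
itself is merely restricted. The converse may fail, since functions on `T` can jump across the
removed set. -/
theorem embeds_kineticN_nullRestrictL2 (hS : IsOpen S) (hT : IsOpen T) (h : T ⊆ S)
    (h0 : volume (S \ T) = 0) (ha : AEStronglyMeasurable a volume)
    (ha2 : LocallyIntegrable (fun x => ‖a x‖ ^ 2) volume) :
    SesqForm.Embeds (nullRestrictL2 h h0).toLinearIsometry (kineticN S a) (kineticN T a) := by
  have he := fun j => SesqForm.Embeds.ofOp (V := (nullRestrictL2 h h0).toLinearIsometry)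
    fun _ _ => mem_graph_magDeriv_restrictL2 hS hT h ha ha2 j
  refine ⟨fun φ hφ => (Submodule.mem_iInf _).2 fun j => (he j).mem φ (magSobolev_le S a j hφ),
    fun φ ψ hφ hψ => ?_⟩
  rw [kineticN_apply, kineticN_apply]
  congr 1
  exact Finset.sum_congr rfl fun j _ => (he j).form_eq φ ψ (magSobolev_le S a j hφ)
    (magSobolev_le S a j hψ)

theorem kineticNormSq_sub_comm (Λ : Set (EuclideanSpace ℝ (Fin d)))
    (φ ψ : (kineticN Λ a).dom) : kineticNormSq Λ a (φ - ψ) = kineticNormSq Λ a (ψ - φ) := by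
  rw [← neg_sub, ← neg_one_smul ℂ, kineticNormSq_smul]
  simp

/-- A general element of the Sobolev space over `T` need not belong to the one over `S`, but test
functions do. The approximating test functions are Cauchy for the Neumann form on `S`, whose
closedness places the limit in its domain. -/
theorem embeds_kineticD_nullRestrictL2_symm (hS : IsOpen S) (hT : IsOpen T) (h : T ⊆ S)
    (h0 : volume (S \ T) = 0) (ha : AEStronglyMeasurable a volume)
    (ha2 : LocallyIntegrable (fun x => ‖a x‖ ^ 2) volume) :
    SesqForm.Embeds (nullRestrictL2 h h0).symm.toLinearIsometry (kinetic BC.D T a)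
      (kinetic BC.D S a) := by
  have hE := embeds_kineticN_nullRestrictL2 hS hT h h0 ha ha2
  have hV := coeFn_nullRestrictL2 h h0
  set V := nullRestrictL2 h h0
  clear_value V
  -- Membership of the transported vectors in the Neumann domain over `S` is assumed here. It is
  -- known at first for test functions only, and for the limit once closedness has been applied.
  have hform : ∀ (φ ψ : L2 T) (hφ : φ ∈ (kineticN T a).dom) (hψ : ψ ∈ (kineticN T a).dom)
      (hφ' : V.symm φ ∈ (kineticN S a).dom) (hψ' : V.symm ψ ∈ (kineticN S a).dom),
      (kineticN S a).form ⟨V.symm φ, hφ'⟩ ⟨V.symm ψ, hψ'⟩ =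
        (kineticN T a).form ⟨φ, hφ⟩ ⟨ψ, hψ⟩ := fun φ ψ hφ hψ hφ' hψ' => by
    rw [← hE.form_eq _ _ hφ' hψ']
    have e1 : (⟨V.toLinearIsometry (V.symm φ), hE.mem _ hφ'⟩ : (kineticN T a).dom) = ⟨φ, hφ⟩ :=
      Subtype.ext (V.apply_symm_apply φ)
    have e2 : (⟨V.toLinearIsometry (V.symm ψ), hE.mem _ hψ'⟩ : (kineticN T a).dom) = ⟨ψ, hψ⟩ :=
      Subtype.ext (V.apply_symm_apply ψ)
    rw [e1, e2]
  have hmem : ∀ φ ∈ dirichletDomain T a, V.symm φ ∈ dirichletDomain S a := by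
    rintro φ ⟨hφ, u, hu, hlim⟩
    have htest : ∀ n, ∃ η, IsTest S η ∧ V.symm (u n : L2 T) =ᵐ[volume.restrict S] η := fun n => by
      obtain ⟨η, hη, hη'⟩ := hu n
      refine ⟨η, hη.mono h, ?_⟩
      have h1 := hV (V.symm (u n : L2 T))
      rw [V.apply_symm_apply] at h1
      exact (ae_restrict_iff_of_null_sdiff h h0 _).2 (h1.symm.trans hη')
    have hdom : ∀ n, V.symm (u n : L2 T) ∈ (kineticN S a).dom := fun n => by
      obtain ⟨η, hη, hη'⟩ := htest n
      exact mem_kineticN_dom_of_isTest hS ha ha2 hη hη'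
    let w : ℕ → (kineticN S a).dom := fun n => ⟨V.symm (u n : L2 T), hdom n⟩
    have hconv : Tendsto (fun n => ‖(u n : L2 T) - φ‖ ^ 2) atTop (𝓝 0) :=
      squeeze_zero (fun _ => sq_nonneg _) (fun n => by
        have h1 := (isClosedNonneg_kineticN hT ha ha2).nonneg (u n - ⟨φ, hφ⟩)
        rw [kineticNormSq, Submodule.coe_sub]
        linarith) hlim
    have hw : Tendsto (fun n => (w n : L2 S)) atTop (𝓝 (V.symm φ)) := by
      refine (V.symm.continuous.tendsto φ).comp (tendsto_iff_norm_sub_tendsto_zero.2 ?_)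
      simpa [Real.sqrt_sq] using hconv.sqrt
    have hquad : ∀ m n, (kineticN S a).quad (w m - w n) = (kineticN T a).quad (u m - u n) :=
      fun m n => by
        have h1 : w m - w n = ⟨V.symm ((u m - u n : (kineticN T a).dom) : L2 T), by
            rw [Submodule.coe_sub, map_sub]; exact (w m - w n).2⟩ :=
          Subtype.ext (map_sub V.symm (u m : L2 T) (u n)).symm
        rw [h1]
        exact congrArg Complex.re (hform _ _ (u m - u n).2 (u m - u n).2 _ _)
    have hcau : Tendsto (fun r : ℕ × ℕ => (kineticN S a).quad (w r.1 - w r.2)) atTop (𝓝 0) := by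
      have h2 : Tendsto (fun r : ℕ × ℕ => 2 * kineticNormSq T a (u r.1 - ⟨φ, hφ⟩) +
          2 * kineticNormSq T a (u r.2 - ⟨φ, hφ⟩)) atTop (𝓝 0) := by
        rw [← prod_atTop_atTop_eq]
        have h3 := ((hlim.comp tendsto_fst).const_mul 2).add
          ((hlim.comp (tendsto_snd (f := (atTop : Filter ℕ)))).const_mul 2)
        rw [mul_zero, add_zero] at h3
        exact h3
      refine squeeze_zero (fun _ => (isClosedNonneg_kineticN hS ha ha2).nonneg _) (fun r => ?_) h2
      rw [hquad, kineticNormSq_sub_comm T (u r.2)]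
      have h3 := kineticNormSq_add T a (u r.1 - ⟨φ, hφ⟩) (⟨φ, hφ⟩ - u r.2)
      rw [sub_add_sub_cancel] at h3
      exact (le_add_of_nonneg_left (sq_nonneg _)).trans h3
    -- This yields both that the limit has weak derivatives across the removed set and that it is
    -- approximated in the form norm over `S`.
    obtain ⟨hφ', hlim'⟩ := (isClosedNonneg_kineticN hS ha ha2).closed w _ hw hcau
    refine ⟨hφ', w, htest, ?_⟩
    have h4 : Tendsto (fun n => ‖(w n : L2 S) - V.symm φ‖ ^ 2) atTop (𝓝 0) := by
      simpa using (tendsto_iff_norm_sub_tendsto_zero.1 hw).pow 2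
    have h5 := h4.add hlim'
    rw [add_zero] at h5
    exact h5
  exact ⟨hmem, fun φ ψ hφ hψ => hform φ ψ hφ.1 hψ.1 _ _⟩

end NullSets

/-! ### Assembling the forms with potential -/

section Bracketing

variable {d : ℕ} {Λ₁ Λ₂ Λ Λ' : Set (EuclideanSpace ℝ (Fin d))}
  {a : EuclideanSpace ℝ (Fin d) → EuclideanSpace ℝ (Fin d)} {v : EuclideanSpace ℝ (Fin d) → ℝ}

theorem embeds_kinetic_DN (Λ : Set (EuclideanSpace ℝ (Fin d)))
    (a : EuclideanSpace ℝ (Fin d) → EuclideanSpace ℝ (Fin d)) :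
    SesqForm.Embeds LinearIsometry.id (kinetic BC.D Λ a) (kinetic BC.N Λ a) :=
  SesqForm.Embeds.restrict _ _ _

/-- A form perturbation of the Neumann form is one for both boundary conditions. -/
theorem isFormPerturbation_kinetic {w : SesqForm (L2 Λ)}
    (h : w.IsFormPerturbation (kinetic BC.N Λ a)) (X : BC) :
    w.IsFormPerturbation (kinetic X Λ a) :=
  match X with
  | BC.N => h
  | BC.D => h.of_embeds (embeds_kinetic_DN Λ a) (SesqForm.Embeds.id w) fun _ => id

theorem embeds_magForm {X Y : BC} {V : L2 Λ →ₗᵢ[ℂ] L2 Λ'}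
    (hk : SesqForm.Embeds V (kinetic X Λ a) (kinetic Y Λ' a))
    (hp : ∀ w, SesqForm.Embeds V (potentialForm Λ w) (potentialForm Λ' w)) :
    SesqForm.Embeds V (magForm X Λ a v) (magForm Y Λ' a v) :=
  (hk.add (hp _)).sub (hp _)

theorem splitsVia_magForm (X : BC) (h₁ : IsOpen Λ₁) (h₂ : IsOpen Λ₂) (hdisj : Disjoint Λ₁ Λ₂)
    (ha : AEStronglyMeasurable a volume) (ha2 : LocallyIntegrable (fun x => ‖a x‖ ^ 2) volume) :
    SesqForm.SplitsVia (splitL2 h₁.measurableSet h₂.measurableSet hdisj)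
      (magForm X (Λ₁ ∪ Λ₂) a v) (magForm X Λ₁ a v) (magForm X Λ₂ a v) :=
  ((splitsVia_kinetic X h₁ h₂ hdisj ha ha2).add (splitsVia_potentialForm _ _ _ _)).sub
    (splitsVia_potentialForm _ _ _ _)

end Bracketing

end MagSchr

/-! ### The proposition -/

theorem mainTheorem8 {d : ℕ}
    (a : EuclideanSpace ℝ (Fin d) → EuclideanSpace ℝ (Fin d))
    (v : EuclideanSpace ℝ (Fin d) → ℝ)
    (ha : AEStronglyMeasurable a volume) (hv : AEStronglyMeasurable v volume)
    (ha_loc : LocallyIntegrable (fun x => ‖a x‖ ^ 2) volume)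
    (hv_loc : LocallyIntegrable (vPos v) volume)
    (Λ₁ Λ₂ : Set (EuclideanSpace ℝ (Fin d)))
    (h₁ : IsOpen Λ₁) (h₂ : IsOpen Λ₂) (hne₁ : Λ₁.Nonempty) (hne₂ : Λ₂.Nonempty)
    (hdisj : Disjoint Λ₁ Λ₂)
    (hpert : SesqForm.IsFormPerturbation (potentialForm (Λ₁ ∪ Λ₂) (vNeg v))
      (kinetic BC.N (Λ₁ ∪ Λ₂) a)) :
    -- the operators on `Λ₁`, `Λ₂` and `Λ₁ ∪ Λ₂` are well defined and decouple
    (∀ X : BC, MagOpDefined X Λ₁ a v ∧ MagOpDefined X Λ₂ a v ∧ MagOpDefined X (Λ₁ ∪ Λ₂) a v ∧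
      EqVia (splitL2 h₁.measurableSet h₂.measurableSet hdisj)
        (magOp X (Λ₁ ∪ Λ₂) a v) (orthSum (magOp X Λ₁ a v) (magOp X Λ₂ a v))) ∧
    -- Dirichlet–Neumann bracketing
    (∀ hnull : volume (interior (closure (Λ₁ ∪ Λ₂)) \ (Λ₁ ∪ Λ₂)) = 0,
      (∀ X : BC, MagOpDefined X (interior (closure (Λ₁ ∪ Λ₂))) a v) ∧
      FormLE (nullRestrictL2 (subset_interior_closure h₁ h₂) hnull).toLinearIsometry
        (magOp BC.N (Λ₁ ∪ Λ₂) a v) (magOp BC.N (interior (closure (Λ₁ ∪ Λ₂))) a v) ∧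
      FormLE LinearIsometry.id
        (magOp BC.N (interior (closure (Λ₁ ∪ Λ₂))) a v)
        (magOp BC.D (interior (closure (Λ₁ ∪ Λ₂))) a v) ∧
      FormLE (nullRestrictL2 (subset_interior_closure h₁ h₂) hnull).symm.toLinearIsometry
        (magOp BC.D (interior (closure (Λ₁ ∪ Λ₂))) a v) (magOp BC.D (Λ₁ ∪ Λ₂) a v)) := by
  have hU := splitsVia_kinetic BC.N h₁ h₂ hdisj ha ha_loc
  have hUp := fun w => splitsVia_potentialForm w h₁.measurableSet h₂.measurableSet hdisj
  -- Extension by zero maps the Neumann domain over `Λ₁` into the one over the union, so the bound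
  -- on the union applies with the same constants.
  have hpert₁ : (potentialForm Λ₁ (vNeg v)).IsFormPerturbation (kinetic BC.N Λ₁ a) :=
    hpert.of_embeds hU.embeds_inl (hUp _).embeds_inl fun φ => ((hUp _).inl_mem_iff φ).1
  have hpert₂ : (potentialForm Λ₂ (vNeg v)).IsFormPerturbation (kinetic BC.N Λ₂ a) :=
    hpert.of_embeds hU.embeds_inr (hUp _).embeds_inr fun φ => ((hUp _).inr_mem_iff φ).1
  have hdef : ∀ (X : BC) (Λ : Set (EuclideanSpace ℝ (Fin d))), IsOpen Λ →
      (potentialForm Λ (vNeg v)).IsFormPerturbation (kinetic BC.N Λ a) → MagOpDefined X Λ a v :=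
    fun X Λ hΛ hp => magOpDefined_of_isFormPerturbation hΛ ha hv ha_loc hv_loc
      (isFormPerturbation_kinetic hp X)
  have hdef₁₂ := fun X => hdef X _ (h₁.union h₂) hpert
  refine ⟨fun X => ⟨hdef X _ h₁ hpert₁, hdef X _ h₂ hpert₂, hdef₁₂ X,
    (splitsVia_magForm X h₁ h₂ hdisj ha ha_loc).eqVia_operator (hdef₁₂ X).2.1.dense
      (hdef X _ h₁ hpert₁).2.1.dense (hdef X _ h₂ hpert₂).2.1.dense⟩, fun hnull => ?_⟩
  have hsub := subset_interior_closure h₁ h₂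
  have hkN := embeds_kineticN_nullRestrictL2 isOpen_interior (h₁.union h₂) hsub hnull ha ha_loc
  have hpN := embeds_potentialForm_nullRestrictL2 hsub hnull
  have hpN' := embeds_potentialForm_nullRestrictL2_symm hsub hnull
  -- The Neumann domain over the larger set restricts into the one over the union, which again
  -- transfers the bound; the inverse restriction `hpN'` brings the domain of `v₋` back.
  have hpertΛ : (potentialForm (interior (closure (Λ₁ ∪ Λ₂))) (vNeg v)).IsFormPerturbation
      (kinetic BC.N (interior (closure (Λ₁ ∪ Λ₂))) a) :=
    hpert.of_embeds hkN (hpN _) fun φ hφ => by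
      have := (hpN' _).mem _ hφ
      rwa [show (nullRestrictL2 hsub hnull).symm.toLinearIsometry
        ((nullRestrictL2 hsub hnull).toLinearIsometry φ) = φ from
        (nullRestrictL2 hsub hnull).symm_apply_apply φ] at this
  have hdefΛ := fun X => hdef X _ isOpen_interior hpertΛ
  -- Each inequality is an embedding of the form on the right into the form on the left: by
  -- restriction, by definition of the Dirichlet form, and by the closure of test functions.
  refine ⟨hdefΛ, ?_, ?_, ?_⟩
  · exact (embeds_magForm (X := BC.N) (Y := BC.N) hkN hpN).formLE (hdef₁₂ BC.N).2.1
      (hdefΛ BC.N).2.1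
  · exact (embeds_magForm (embeds_kinetic_DN _ a) fun _ => SesqForm.Embeds.id _).formLE
      (hdefΛ BC.N).2.1 (hdefΛ BC.D).2.1
  · exact (embeds_magForm (embeds_kineticD_nullRestrictL2_symm isOpen_interior (h₁.union h₂) hsub
      hnull ha ha_loc) hpN').formLE (hdefΛ BC.D).2.1 (hdef₁₂ BC.D).2.1
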